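/- **Theorem (structure learning from positive-time queries).** Let $\{\mathbb I,X,Y,Z\}^{\otimes n}$ be the $n$-qubit Pauli operators. An $n$-qubit Hamiltonian is $H=\sum_{a=1}^m\lambda_aE_a$ with distinct Pauli operators $E_a$ and real $\lambda_a$; for $\epsilon>0$ let $S_\epsilon(H)=\{E_a:|\lambda_a|>\epsilon\}$, and let $\|H\|$ be the operator norm. A *learner* runs finitely many independent experiments (prepare a state of the $n$ system qubits and some ancilla qubits; apply a circuit $V_L\,Q_L\,V_{L-1}\cdots V_1\,Q_1\,V_0$; measure) and computes from the outcomes a finite set $\widehat S$ of Pauli operators. The initial states, the unitaries $V_j$, the measurements and the post-processing do not depend on $H$. Each query $Q_j$ is $\mathbb I\otimes e^{-\mathrm iHt_j}$ (an uncontrolled query), or this evolution controlled on some ancilla qubits being in a fixed computational basis state, with $t_j\ge 0$. The total number of the $Q_j$ is the number of queries, and the total of the $t_j$ is the evolution time. For given $\Delta,\epsilon,\delta$ the learner *succeeds* if $|\widehat S|$ never exceeds its number of queries and, for all $m$ and all $n$-qubit $H=\sum_{a=1}^m\lambda_aE_a$ with $2\|H\|\le\Delta$, $$\Pr\big[S_\epsilon(H)\subseteq\widehat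 S\,\big]\ \ge\ 1-\delta .$$ There are universal constants $C>0$ and $k\in\mathbb N$ such that for all $n$, $\Delta>0$, $\epsilon>0$ and $\delta\in(0,1)$ the following two statements hold, where "the cost bound" means that the learner makes at most $$C\,\frac{\Delta^4}{\epsilon^4}\,\log^k\!\Big(2+\frac\Delta\epsilon\Big)\Big(1+\log\frac1\delta\Big)\ \text{queries and uses at most}\ \ C\,\frac{\Delta^3}{\epsilon^4}\,\log^k\!\Big(2+\frac\Delta\epsilon\Big)\Big(1+\log\frac1\delta\Big)\ \text{evolution time}.$$ 1. There is a learner, all of whose queries are uncontrolled positive-time queries $e^{-\mathrm iHt}$, $t\ge0$, that succeeds and satisfies the cost bound. 2. There are integers $K\ge1$ and $N\ge0$ such that the following Bell sampling learner, which makes only controlled positive-time queries, succeeds and satisfies the cost bound. Let $U=e^{-\mathrm iH/\Delta}$, $L_K(U)=\sum_{k=1}^K\frac{(-1)^{k+1}}k(U-\mathbb I)^k$, $c_0=-\sum_{k=1}^K\frac1k$, $c_j=\frac{(-1)^{j+1}}j\binom Kj$ for $1\le j\le K$, $\Lambda=\sum_{j=0}^K|c_j|$, $q=\lceil\log_2(K+1)\rceil$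 and $|\Omega\rangle=2^{-n/2}\sum_b|b\rangle|b\rangle$. Unitaries $P_L,P_R$ on $q$ qubits with $\Lambda\,\overline{\langle j|P_L|0^q\rangle}\,\langle j|P_R|0^q\rangle=\mathrm i c_j$ for $0\le j\le K$ and $\overline{\langle j|P_L|0^q\rangle}\langle j|P_R|0^q\rangle=0$ for $K<j<2^q$ exist, and any such pair may be used. Each of $N$ independent attempts applies $(P_L^\dagger\otimes\mathbb I)\,\mathsf{SEL}\,(P_R\otimes\mathbb I)$ to $|0^q\rangle|\Omega\rangle$, where $\mathsf{SEL}$ applies $U^j=e^{-\mathrm iHj/\Delta}$ to the system, controlled on the $q$ flag qubits being in the state $j$, for $j=1,\dots,K$; then it measures the flag qubits in the computational basis and the other $2n$ qubits in the Bell basis $\{(P\otimes\mathbb I)|\Omega\rangle\}_P$. The output $\widehat S$ is the set of the Bell outcomes $P$ of the attempts with flag outcome $0^q$. Moreover, for every Hermitian $H$, the unnormalized state of the $2n$ qubits after flag outcome $0^q$ is $$\frac{\|(\mathrm iL_K(U)\otimes\mathbb I)|\Omega\rangle\|}{\Lambda}\,|\Psi(\mathrm i\Delta L_K(U))\rangle,\qquad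 |\Psi(A)\rangle=\frac{(A\otimes\mathbb I)|\Omega\rangle}{\|(A\otimes\mathbb I)|\Omega\rangle\|},$$ that is, a multiple of the referenceless pseudo-Choi state of $\mathrm i\Delta L_K(U)$ (and $0$ if $L_K(U)=0$). -/

import Mathlib

open scoped Kronecker NNReal ComplexOrder

namespace HamLearn

noncomputable section

/-! ### Pauli operators and Hamiltonians -/

/-- The labels of the four single-qubit Pauli matrices. -/
inductive Pauli
  | I | X | Y | Z
  deriving DecidableEq

instance : Fintype Pauli where
  elems := {.I, .X, .Y, .Z}
  complete x := by cases x <;> simp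

/-- Single-qubit Pauli matrices; `false` is the basis state `0` and `true` is the basis state `1`. -/
def Pauli.matrix : Pauli → Matrix Bool Bool ℂ
  | .I => 1
  | .X => Matrix.of fun a b => if a = b then 0 else 1
  | .Y => Matrix.of fun a b => if a = b then 0 else if a then Complex.I else -Complex.I
  | .Z => Matrix.of fun a b => if a = b then (if a then -1 else 1) else 0

/-- Computational basis states of `n` qubits. -/
abbrev Bits (n : ℕ) := Fin n → Bool

/-- Labels of the `4 ^ n` Pauli operators on `n` qubits. -/
abbrev PauliString (n : ℕ) := Fin n → Pauli

/-- The `n`-qubit Pauli operator, the tensor product of its single-qubit factors. -/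
def PauliString.matrix {n : ℕ} (P : PauliString n) : Matrix (Bits n) (Bits n) ℂ :=
  Matrix.of fun x y => ∏ i, (P i).matrix (x i) (y i)

/-- The Hamiltonian `∑ a, lam a • E a` with real parameters `lam` and Pauli terms `E`. -/
def hamiltonian {n m : ℕ} (E : Fin m → PauliString n) (lam : Fin m → ℝ) :
    Matrix (Bits n) (Bits n) ℂ :=
  ∑ a, (lam a : ℂ) • (E a).matrix

/-- The set of terms whose weight is greater than `ε` in absolute value. -/
def heavyTerms {n m : ℕ} (E : Fin m → PauliString n) (lam : Fin m → ℝ) (ε : ℝ) :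
    Set (PauliString n) :=
  {P | ∃ a, E a = P ∧ ε < |lam a|}

/-- The operator norm of a matrix with respect to the Euclidean norm. -/
def opNorm {n : ℕ} (A : Matrix (Bits n) (Bits n) ℂ) : ℝ :=
  ‖Matrix.toEuclideanCLM (𝕜 := ℂ) A‖

/-- The time evolution operator `exp (-i H t)`. -/
def evolution {n : ℕ} (H : Matrix (Bits n) (Bits n) ℂ) (t : ℝ) : Matrix (Bits n) (Bits n) ℂ :=
  NormedSpace.exp ((-Complex.I * (t : ℂ)) • H)

/-! ### Forward-time quantum experiments

The joint system consists of ancilla qubits, labelled by a finite type `α`, and of the `n` qubits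
on which the unknown Hamiltonian acts. -/

/-- Computational basis states of the joint system (ancillas first). -/
abbrev Joint (n : ℕ) (α : Type) := (α → Bool) × Bits n

/-- A query to the time evolution for a non-negative time. Ancilla `i` is a control qubit with
control value `b` if `control i = some b`, and is not involved if `control i = none`. -/
structure Query (α : Type) where
  time : ℝ≥0
  control : α → Option Bool

/-- The query is to `exp (-i H t)` itself, with no control qubits. -/
def Query.Uncontrolled {α : Type} (q : Query α) : Prop := ∀ i, q.control i = none

/-- The projector onto the ancilla states in which all control qubits have their control value. -/
def Query.projector {α : Type} [Fintype α] [DecidableEq α] (q : Query α) :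
    Matrix (α → Bool) (α → Bool) ℂ :=
  Matrix.diagonal fun x => if ∀ i b, q.control i = some b → x i = b then 1 else 0

/-- The (multi-)controlled time evolution `Π ⊗ exp (-i H t) + (1 - Π) ⊗ 1`. It is
`1 ⊗ exp (-i H t)` if the query is uncontrolled. -/
def Query.gate {n : ℕ} {α : Type} [Fintype α] [DecidableEq α] (q : Query α)
    (H : Matrix (Bits n) (Bits n) ℂ) : Matrix (Joint n α) (Joint n α) ℂ :=
  q.projector ⊗ₖ evolution H q.time + (1 - q.projector) ⊗ₖ 1

/-- A discrete-control circuit `V_L · query_L · V_{L-1} ⋯ V_1 · query_1 · V_0`. The unitaries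
`V_j` act jointly on the system and the ancillas and do not depend on the Hamiltonian. -/
structure ControlCircuit (n : ℕ) (α : Type) [Fintype α] [DecidableEq α] where
  first : Matrix.unitaryGroup (Joint n α) ℂ
  steps : List (Query α × Matrix.unitaryGroup (Joint n α) ℂ)

namespace ControlCircuit

variable {n : ℕ} {α : Type} [Fintype α] [DecidableEq α]

/-- The operator which the circuit implements when the unknown Hamiltonian is `H`. -/
def eval (C : ControlCircuit n α) (H : Matrix (Bits n) (Bits n) ℂ) :
    Matrix (Joint n α) (Joint n α) ℂ :=
  C.steps.foldl (fun W s => (s.2 : Matrix (Joint n α) (Joint n α) ℂ) * s.1.gate H * W)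
    (C.first : Matrix (Joint n α) (Joint n α) ℂ)

/-- The number of queries to the time evolution. -/
def queries (C : ControlCircuit n α) : ℕ := C.steps.length

/-- The evolution time. -/
def time (C : ControlCircuit n α) : ℝ≥0 := (C.steps.map fun s => s.1.time).sum

end ControlCircuit

/-- A prepare--evolve--measure experiment: an initial pure state, a discrete-control circuit and
a measurement (a positive operator-valued measure) with outcomes in `Ω`. -/
structure Experiment (n : ℕ) (α Ω : Type) [Fintype α] [DecidableEq α] [Fintype Ω] where
  init : Joint n α → ℂ
  init_norm : star init ⬝ᵥ init = 1
  circuit : ControlCircuit n α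
  effect : Ω → Matrix (Joint n α) (Joint n α) ℂ
  effect_pos : ∀ ω, (effect ω).PosSemidef
  effect_sum : ∑ ω, effect ω = 1

namespace Experiment

variable {n : ℕ} {α Ω : Type} [Fintype α] [DecidableEq α] [Fintype Ω]

/-- The state right before the measurement. -/
def final (e : Experiment n α Ω) (H : Matrix (Bits n) (Bits n) ℂ) : Joint n α → ℂ :=
  (e.circuit.eval H).mulVec e.init

/-- The probability of an outcome (Born's rule). -/
def prob (e : Experiment n α Ω) (H : Matrix (Bits n) (Bits n) ℂ) (ω : Ω) : ℝ :=
  (star (e.final H) ⬝ᵥ (e.effect ω).mulVec (e.final H)).re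

end Experiment

/-- A structure learner: finitely many independent experiments, followed by classical
post-processing of their outcomes, which returns a finite set of Pauli terms. -/
structure Learner (n : ℕ) (α Ω : Type) [Fintype α] [DecidableEq α] [Fintype Ω] where
  count : ℕ
  experiment : Fin count → Experiment n α Ω
  output : (Fin count → Ω) → Finset (PauliString n)

namespace Learner

variable {n : ℕ} {α Ω : Type} [Fintype α] [DecidableEq α] [Fintype Ω]

/-- The total number of queries of the learner. -/
def queries (L : Learner n α Ω) : ℕ := ∑ i, (L.experiment i).circuit.queries

/-- The total evolution time of the learner. -/
def time (L : Learner n α Ω) : ℝ≥0 := ∑ i, (L.experiment i).circuit.time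

/-- All queries of the learner are queries to `exp (-i H t)` itself, without control qubits. -/
def Uncontrolled (L : Learner n α Ω) : Prop :=
  ∀ i, ∀ s ∈ (L.experiment i).circuit.steps, s.1.Uncontrolled

open Classical in
/-- The probability that the output contains all elements of `S`, when the unknown Hamiltonian
is `H` and the experiments are independent. -/
def successProb (L : Learner n α Ω) (H : Matrix (Bits n) (Bits n) ℂ)
    (S : Set (PauliString n)) : ℝ :=
  ∑ ω : Fin L.count → Ω,
    if S ⊆ (L.output ω : Set (PauliString n)) then ∏ i, (L.experiment i).prob H (ω i) else 0

/-- The learner never returns more terms than it makes queries and, for every Hamiltonian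
`H = ∑ a, lam a • E a` with distinct terms and `Δ ≥ 2 ‖H‖`, with probability at least `1 - δ` its
output contains every term of weight greater than `ε`. -/
def LearnsStructure (L : Learner n α Ω) (Δ : ℝ≥0) (ε δ : ℝ) : Prop :=
  (∀ ω, (L.output ω).card ≤ L.queries) ∧
  ∀ (m : ℕ) (E : Fin m → PauliString n) (lam : Fin m → ℝ), Function.Injective E →
    2 * opNorm (hamiltonian E lam) ≤ Δ →
    1 - δ ≤ L.successProb (hamiltonian E lam) (heavyTerms E lam ε)

/-- The costs of the learner are at most `C Δ⁴ / ε⁴` queries and `C Δ³ / ε⁴` evolution time, up to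
the factor `log (2 + Δ / ε) ^ k` and the factor `1 + log (1 / δ)` for failure probability `δ`. -/
def CostBound (L : Learner n α Ω) (C : ℝ) (k : ℕ) (Δ : ℝ≥0) (ε δ : ℝ) : Prop :=
  (L.queries : ℝ) ≤
    C * ((Δ : ℝ) ^ 4 / ε ^ 4) * Real.log (2 + Δ / ε) ^ k * (1 + Real.log (1 / δ)) ∧
  (L.time : ℝ) ≤
    C * ((Δ : ℝ) ^ 3 / ε ^ 4) * Real.log (2 + Δ / ε) ^ k * (1 + Real.log (1 / δ))

end Learner

/-! ### Pseudo-Choi states and the truncated matrix logarithm -/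

/-- The maximally entangled state of the system (first factor) and a copy of it. -/
def maxEnt (n : ℕ) : Bits n × Bits n → ℂ :=
  fun p => if p.1 = p.2 then ((1 / √(2 ^ n) : ℝ) : ℂ) else 0

/-- The vector `(A ⊗ 1) |Ω⟩`. -/
def choiVec {n : ℕ} (A : Matrix (Bits n) (Bits n) ℂ) : Bits n × Bits n → ℂ :=
  (A ⊗ₖ (1 : Matrix (Bits n) (Bits n) ℂ)).mulVec (maxEnt n)

/-- The Euclidean norm of a vector. -/
def vecNorm {ι : Type} [Fintype ι] (v : ι → ℂ) : ℝ := √(∑ i, ‖v i‖ ^ 2)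

/-- The referenceless pseudo-Choi state `(A ⊗ 1) |Ω⟩ / ‖(A ⊗ 1) |Ω⟩‖`. -/
def pseudoChoi {n : ℕ} (A : Matrix (Bits n) (Bits n) ℂ) : Bits n × Bits n → ℂ :=
  ((vecNorm (choiVec A) : ℂ)⁻¹) • choiVec A

/-- The partial sum of the power series of the matrix logarithm. -/
def logPartial {n : ℕ} (K : ℕ) (A : Matrix (Bits n) (Bits n) ℂ) : Matrix (Bits n) (Bits n) ℂ :=
  ∑ k ∈ Finset.Icc 1 K, ((-1 : ℂ) ^ (k + 1) / (k : ℂ)) • (A - 1) ^ k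

/-- The coefficients `c_j` of `logPartial K U` as a linear combination of the powers `U ^ j`. -/
def logCoeff (K j : ℕ) : ℝ :=
  if j = 0 then -∑ k ∈ Finset.Icc 1 K, (1 : ℝ) / k
  else (-1) ^ (j + 1) / (j : ℝ) * (K.choose j : ℝ)

/-- The `ℓ¹`-norm of the coefficients. -/
def logNorm (K : ℕ) : ℝ := ∑ j ∈ Finset.range (K + 1), |logCoeff K j|

/-- The number of control qubits, the ceiling of `log₂ (K + 1)`. -/
def flagQubits (K : ℕ) : ℕ := Nat.clog 2 (K + 1)

/-- The binary digits of `j`, as a basis state of `b` qubits. -/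
def digits (b j : ℕ) : Bits b := fun i => j.testBit i

/-- `(PL, PR)` is a `(β, b, η)`-state-preparation pair for `y`. -/
def IsStatePrepPair {M b : ℕ} (β η : ℝ) (y : Fin M → ℂ)
    (PL PR : Matrix.unitaryGroup (Bits b) ℂ) : Prop :=
  M ≤ 2 ^ b ∧ ∑ j, ‖y j‖ ≤ β ∧
  ∑ j : Fin M, ‖(β : ℂ) * (star (PL.1 (digits b j) (digits b 0)) *
    PR.1 (digits b j) (digits b 0)) - y j‖ ≤ η ∧
  ∀ j, M ≤ j → j < 2 ^ b →
    star (PL.1 (digits b j) (digits b 0)) * PR.1 (digits b j) (digits b 0) = 0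

/-- `(PL, PR)` is an exact state-preparation pair for the coefficients `i c_0, …, i c_K`. -/
def IsLogPrepPair (K : ℕ) (PL PR : Matrix.unitaryGroup (Bits (flagQubits K)) ℂ) : Prop :=
  IsStatePrepPair (M := K + 1) (logNorm K) 0
    (fun j => Complex.I * (logCoeff K j : ℂ)) PL PR

/-! ### Bell sampling of the pseudo-Choi state of the truncated logarithm

The ancillas are `q` flag qubits and `n` reference qubits. -/

/-- The joint state with flag `f`, reference `r` and system state `s`. -/
def joint {n q : ℕ} (f : Bits q) (s r : Bits n) : Joint n (Fin q ⊕ Fin n) := (Sum.elim f r, s)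

/-- The flag register of a joint basis state. -/
def flagOf {n q : ℕ} (p : Joint n (Fin q ⊕ Fin n)) : Bits q := fun i => p.1 (Sum.inl i)

/-- The system and reference registers of a joint basis state. -/
def dataOf {n q : ℕ} (p : Joint n (Fin q ⊕ Fin n)) : Bits n × Bits n :=
  (p.2, fun i => p.1 (Sum.inr i))

/-- The joint basis states, as pairs of a flag and a state of system and reference. -/
def jointEquiv (n q : ℕ) : Bits q × (Bits n × Bits n) ≃ Joint n (Fin q ⊕ Fin n) where
  toFun p := joint p.1 p.2.1 p.2.2
  invFun p := (flagOf p, dataOf p)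
  left_inv p := by
    rcases p with ⟨f, s, r⟩
    rfl
  right_inv p := by
    rcases p with ⟨x, s⟩
    refine Prod.ext ?_ rfl
    funext i
    cases i <;> rfl

/-- The gate `V ⊗ 1`, which applies `V` to the flag register. -/
def onFlag {n q : ℕ} (V : Matrix.unitaryGroup (Bits q) ℂ) :
    Matrix.unitaryGroup (Joint n (Fin q ⊕ Fin n)) ℂ :=
  ⟨Matrix.reindex (jointEquiv n q) (jointEquiv n q)
      ((V : Matrix (Bits q) (Bits q) ℂ) ⊗ₖ (1 : Matrix (Bits n × Bits n) (Bits n × Bits n) ℂ)), by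
    have h := Matrix.kronecker_mem_unitary V.2
      (one_mem (unitary (Matrix (Bits n × Bits n) (Bits n × Bits n) ℂ)))
    rw [Matrix.mem_unitaryGroup_iff, Matrix.star_eq_conjTranspose]
    have h2 := (Unitary.mem_iff.1 h).2
    rw [Matrix.star_eq_conjTranspose] at h2
    rw [Matrix.conjTranspose_reindex, Matrix.reindex_apply, Matrix.reindex_apply,
      Matrix.submatrix_mul_equiv, h2, Matrix.submatrix_one_equiv]⟩

/-- The query to `exp (-i H j t)` controlled on the flag register being in the state `j`. -/
def selectQuery (n q j : ℕ) (t : ℝ≥0) : Query (Fin q ⊕ Fin n) where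
  time := j * t
  control := Sum.elim (fun i => some (digits q j i)) (fun _ => none)

/-- The circuit `(PL† ⊗ 1) · SEL · (PR ⊗ 1)`, where `SEL` applies, controlled on the flag register
being `j`, the operator `U ^ j` with `U = exp (-i H / Δ)`, for `j = 1, …, K` (nothing is applied
for `j = 0`). It is meant for `1 ≤ K`. -/
def logCircuit (n K : ℕ) (Δ : ℝ≥0) (PL PR : Matrix.unitaryGroup (Bits (flagQubits K)) ℂ) :
    ControlCircuit n (Fin (flagQubits K) ⊕ Fin n) where
  first := onFlag PR
  steps := (List.range K).map fun j =>
    (selectQuery n (flagQubits K) (j + 1) Δ⁻¹, if j + 1 = K then onFlag (star PL) else 1)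

/-- The initial state: all flag qubits are `0`; system and reference are maximally entangled. -/
def bellInit (n q : ℕ) : Joint n (Fin q ⊕ Fin n) → ℂ :=
  fun p => if flagOf p = digits q 0 then maxEnt n (dataOf p) else 0

/-- The measurement vector `|f⟩ ⊗ (P ⊗ 1) |Ω⟩`: flag outcome `f` and Bell outcome `P`. -/
def bellVec {n q : ℕ} (ω : Bits q × PauliString n) : Joint n (Fin q ⊕ Fin n) → ℂ :=
  fun p => if flagOf p = ω.1 then choiVec ω.2.matrix (dataOf p) else 0

/-! The following facts show that these data are an experiment. -/

theorem choiVec_apply {n : ℕ} (A : Matrix (Bits n) (Bits n) ℂ) (s r : Bits n) :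
    choiVec A (s, r) = A s r * ((1 / √(2 ^ n) : ℝ) : ℂ) := by
  rw [choiVec, Matrix.mulVec, dotProduct, Fintype.sum_prod_type, Finset.sum_eq_single r]
  · rw [Finset.sum_eq_single r]
    · simp [maxEnt]
    · intro b _ hb
      simp [Matrix.one_apply_ne' hb]
    · simp
  · intro a _ ha
    refine Finset.sum_eq_zero fun b _ => ?_
    by_cases hb : r = b
    · subst hb
      simp [maxEnt, ha]
    · simp [Matrix.one_apply_ne hb]
  · simp

theorem sqrt_weight (n : ℕ) :
    ((1 / √(2 ^ n) : ℝ) : ℂ) * ((1 / √(2 ^ n) : ℝ) : ℂ) = 1 / 2 ^ n := by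
  rw [← Complex.ofReal_mul, div_mul_div_comm, one_mul, Real.mul_self_sqrt (by positivity)]
  push_cast
  rfl

theorem sum_pauli (a b c d : Bool) :
    ∑ P : Pauli, P.matrix a b * star (P.matrix c d) = if a = c ∧ b = d then 2 else 0 := by
  have h : (Finset.univ : Finset Pauli) = {.I, .X, .Y, .Z} := rfl
  rw [h]
  cases a <;> cases b <;> cases c <;> cases d <;>
    simp [Pauli.matrix] <;> norm_num

theorem sum_pauliString {n : ℕ} (s r s' r' : Bits n) :
    ∑ P : PauliString n, P.matrix s r * star (P.matrix s' r') =
      if s = s' ∧ r = r' then 2 ^ n else 0 := by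
  have h : ∀ P : PauliString n, P.matrix s r * star (P.matrix s' r') =
      ∏ i, (P i).matrix (s i) (r i) * star ((P i).matrix (s' i) (r' i)) := by
    intro P
    simp only [PauliString.matrix, Matrix.of_apply, star_prod, Finset.prod_mul_distrib]
  simp only [h]
  rw [← Fintype.prod_sum
    (f := fun i (p : Pauli) => p.matrix (s i) (r i) * star (p.matrix (s' i) (r' i)))]
  simp only [sum_pauli]
  by_cases hs : s = s' ∧ r = r'
  · obtain ⟨rfl, rfl⟩ := hs
    simp
  · rw [if_neg hs]
    have : ∃ i, ¬ (s i = s' i ∧ r i = r' i) := by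
      by_contra hc
      push Not at hc
      exact hs ⟨funext fun i => (hc i).1, funext fun i => (hc i).2⟩
    obtain ⟨i, hi⟩ := this
    exact Finset.prod_eq_zero (Finset.mem_univ i) (if_neg hi)

theorem bellInit_norm (n q : ℕ) : star (bellInit n q) ⬝ᵥ bellInit n q = 1 := by
  rw [dotProduct, ← (jointEquiv n q).sum_comp, Fintype.sum_prod_type,
    Finset.sum_eq_single (digits q 0)]
  · have h : ∀ p : Bits n × Bits n,
        star (bellInit n q) (jointEquiv n q (digits q 0, p)) *
          bellInit n q (jointEquiv n q (digits q 0, p)) =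
        if p.1 = p.2 then 1 / 2 ^ n else 0 := by
      intro p
      have h1 : bellInit n q (jointEquiv n q (digits q 0, p)) = maxEnt n p := if_pos rfl
      rw [Pi.star_apply, h1, maxEnt]
      split_ifs
      · rw [← sqrt_weight, Complex.star_def, Complex.conj_ofReal]
      · simp
    simp only [h]
    rw [Fintype.sum_prod_type]
    simp
  · intro f _ hf
    refine Finset.sum_eq_zero fun p _ => ?_
    have h1 : bellInit n q (jointEquiv n q (f, p)) = 0 := if_neg hf
    rw [h1, mul_zero]
  · simp

theorem bell_sum (n q : ℕ) :
    ∑ ω : Bits q × PauliString n,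
      Matrix.vecMulVec (bellVec (n := n) (q := q) ω) (star (bellVec ω)) = 1 := by
  ext p p'
  rw [Matrix.sum_apply, Fintype.sum_prod_type, Finset.sum_eq_single (flagOf p)]
  · simp only [Matrix.vecMulVec_apply, Pi.star_apply, bellVec, if_true]
    by_cases hf : flagOf p' = flagOf p
    · have h : ∀ P : PauliString n, choiVec P.matrix (dataOf p) *
          star (if flagOf p' = flagOf p then choiVec P.matrix (dataOf p') else 0) =
          (P.matrix (dataOf p).1 (dataOf p).2 * star (P.matrix (dataOf p').1 (dataOf p').2)) *
            (1 / 2 ^ n) := by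
        intro P
        have h1 := choiVec_apply P.matrix (dataOf p).1 (dataOf p).2
        have h2 := choiVec_apply P.matrix (dataOf p').1 (dataOf p').2
        rw [Prod.mk.eta] at h1 h2
        rw [if_pos hf, h1, h2, star_mul', ← sqrt_weight]
        simp only [Complex.star_def, Complex.conj_ofReal]
        ring
      simp only [h]
      rw [← Finset.sum_mul, sum_pauliString]
      by_cases hp : p = p'
      · subst hp
        simp
      · have : ¬ ((dataOf p).1 = (dataOf p').1 ∧ (dataOf p).2 = (dataOf p').2) := by
          rintro ⟨h1, h2⟩
          exact hp ((jointEquiv n q).symm.injective (Prod.ext hf.symm (Prod.ext h1 h2)))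
        rw [if_neg this, Matrix.one_apply_ne hp, zero_mul]
    · have hp : p ≠ p' := fun h => hf (by rw [h])
      simp [hf, Matrix.one_apply_ne hp]
  · intro f _ hf
    refine Finset.sum_eq_zero fun P _ => ?_
    rw [Matrix.vecMulVec_apply, bellVec, if_neg (fun h => hf h.symm), zero_mul]
  · simp

/-- One attempt: run the circuit for the truncated logarithm on the flag qubits and one half of
the maximally entangled state; measure the flag qubits in the computational basis, and system and
reference in the Bell basis. -/
def logExperiment (n K : ℕ) (Δ : ℝ≥0) (PL PR : Matrix.unitaryGroup (Bits (flagQubits K)) ℂ) :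
    Experiment n (Fin (flagQubits K) ⊕ Fin n) (Bits (flagQubits K) × PauliString n) where
  init := bellInit n (flagQubits K)
  init_norm := bellInit_norm n (flagQubits K)
  circuit := logCircuit n K Δ PL PR
  effect ω := Matrix.vecMulVec (bellVec ω) (star (bellVec ω))
  effect_pos ω := Matrix.posSemidef_vecMulVec_self_star (bellVec ω)
  effect_sum := bell_sum n (flagQubits K)

open Classical in
/-- Bell sampling: make `N` independent attempts, and return the Bell outcomes of those attempts
in which all flag qubits were found to be `0`. -/
def logLearner (n K N : ℕ) (Δ : ℝ≥0) (PL PR : Matrix.unitaryGroup (Bits (flagQubits K)) ℂ) :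
    Learner n (Fin (flagQubits K) ⊕ Fin n) (Bits (flagQubits K) × PauliString n) where
  count := N
  experiment _ := logExperiment n K Δ PL PR
  output ω := Finset.univ.filter fun P => ∃ i, ω i = (digits (flagQubits K) 0, P)

/-- The unnormalized state of system and reference after the flag qubits were found to be `0`. -/
def flaggedState {n : ℕ} (K : ℕ) (Δ : ℝ≥0) (PL PR : Matrix.unitaryGroup (Bits (flagQubits K)) ℂ)
    (H : Matrix (Bits n) (Bits n) ℂ) : Bits n × Bits n → ℂ :=
  fun p => (logExperiment n K Δ PL PR).final H (joint (digits (flagQubits K) 0) p.1 p.2)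

end

end HamLearn

open Matrix

namespace HamLearn

/-! The Bell states `choiVec P.matrix` form an orthonormal basis, so a Bell measurement of `(A ⊗
1)|Ω⟩` has outcome `P` with probability `‖pauliCoeff P A‖ ^ 2`, the squared Pauli coefficient of `A`
(for non-unitary `A`, an unnormalized probability). It thus suffices to prepare an operator `A`
whose coefficient at every heavy term is not too small, and to repeat.

Write R = Δ/ε. By Parseval at most R² terms are heavy (`ncard_heavyTerms_mul_le`). If each appears
with probability at least 1/(64 R⁴) per experiment, a union bound (`Learner.successProb_ge`) shows
that about 64 R⁴ (2 log R + log(1/δ)) experiments find all of them. If R ≤ 2, then ‖H‖ ≤ ε, there is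
no heavy term, and no experiment is needed. `Learner.learnsStructure` and `Learner.costBound` carry
out this reduction for both learners.

For uncontrolled queries, A = exp(-iHt) with t = ε/Δ². The identity has real Pauli coefficients and
-itH imaginary ones, so they cannot cancel: a heavy coefficient is at least tε minus the quadratic
error (t‖H‖)², which is of order R⁻² (`norm_pauliCoeff_evolution_ge`).

For the truncated logarithm, the flagged operator is i L_K(U)/Λ. Since ‖H‖/Δ ≤ 1/2, the series
approximates H/Δ with error at most 2^-(K+1) (`norm_pauliCoeff_logPartial_ge`), while Λ ≤ 2^(K+1)
(`logNorm_le`). Choosing K with R < 2^K ≤ 2R leaves a heavy coefficient of at least 1/(2R), and Λ ≤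
4R, hence probability at least (1/(8R²))² = 1/(64 R⁴).

In both cases an operator-norm error bounds the error of each single coefficient
(`norm_pauliCoeff_le`), and the operator norms are computed on the spectrum
(`exists_diagonalization`). -/

/-! ### Pauli coefficients and Parseval's identity -/

theorem choiVec_add {n : ℕ} (A B : Matrix (Bits n) (Bits n) ℂ) :
    choiVec (A + B) = choiVec A + choiVec B := by
  ext ⟨s, r⟩
  simp [choiVec_apply, add_mul]

theorem choiVec_smul {n : ℕ} (c : ℂ) (A : Matrix (Bits n) (Bits n) ℂ) :
    choiVec (c • A) = c • choiVec A := by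
  ext ⟨s, r⟩
  simp [choiVec_apply, mul_assoc]

theorem choiVec_one (n : ℕ) : choiVec (1 : Matrix (Bits n) (Bits n) ℂ) = maxEnt n := by
  simp [choiVec]

theorem choiVec_zero (n : ℕ) : choiVec (0 : Matrix (Bits n) (Bits n) ℂ) = 0 := by
  simp [choiVec]

/-- The coefficient of the Pauli operator `P` in the Pauli expansion of `A`. -/
noncomputable def pauliCoeff {n : ℕ} (P : PauliString n) :
    Matrix (Bits n) (Bits n) ℂ →ₗ[ℂ] ℂ where
  toFun A := star (choiVec P.matrix) ⬝ᵥ choiVec A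
  map_add' A B := by rw [choiVec_add, dotProduct_add]
  map_smul' c A := by rw [choiVec_smul, dotProduct_smul]; rfl

theorem pauliCoeff_apply {n : ℕ} (P : PauliString n) (A : Matrix (Bits n) (Bits n) ℂ) :
    pauliCoeff P A = star (choiVec P.matrix) ⬝ᵥ choiVec A := rfl

theorem sum_star_pauli_mul (p q : Pauli) :
    ∑ a, ∑ b, star (p.matrix a b) * q.matrix a b = if p = q then 2 else 0 := by
  cases p <;> cases q <;> simp [Pauli.matrix] <;> norm_num

/-- The inner product factorises over the qubits, which reduces orthonormality to the four
single-qubit matrices. -/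
theorem pauliCoeff_matrix {n : ℕ} (P Q : PauliString n) :
    pauliCoeff P Q.matrix = if P = Q then 1 else 0 := by
  have h : ∀ s r : Bits n, star (choiVec P.matrix (s, r)) * choiVec Q.matrix (s, r) =
      (1 / 2 ^ n) * ∏ i, star ((P i).matrix (s i) (r i)) * (Q i).matrix (s i) (r i) := by
    intro s r
    rw [choiVec_apply, choiVec_apply, ← sqrt_weight, star_mul']
    simp only [PauliString.matrix, of_apply, star_prod, Finset.prod_mul_distrib,
      Complex.star_def, Complex.conj_ofReal]
    ring
  rw [pauliCoeff_apply, dotProduct, Fintype.sum_prod_type]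
  simp only [Pi.star_apply, h, ← Finset.mul_sum]
  have h2 : ∑ s : Bits n, ∑ r : Bits n,
      ∏ i, star ((P i).matrix (s i) (r i)) * (Q i).matrix (s i) (r i) =
      ∏ i, ∑ a, ∑ b, star ((P i).matrix a b) * (Q i).matrix a b := by
    rw [Fintype.prod_sum]
    refine Finset.sum_congr rfl fun s _ => ?_
    rw [Fintype.prod_sum]
  rw [h2]
  simp only [sum_star_pauli_mul]
  by_cases hPQ : P = Q
  · subst hPQ
    simp
  · obtain ⟨i, hi⟩ := Function.ne_iff.1 hPQ
    rw [if_neg hPQ, Finset.prod_eq_zero (Finset.mem_univ i) (if_neg hi), mul_zero]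

theorem identity_matrix (n : ℕ) : PauliString.matrix (fun _ : Fin n => Pauli.I) = 1 := by
  ext x y
  simp only [PauliString.matrix, of_apply, Pauli.matrix, one_apply]
  by_cases h : x = y
  · subst h
    simp
  · obtain ⟨i, hi⟩ := Function.ne_iff.1 h
    rw [if_neg h, Finset.prod_eq_zero (Finset.mem_univ i) (if_neg hi)]

/-- Keeps the identity term of exp(-iHt) from cancelling the imaginary first-order term when `P` is
itself the identity. -/
theorem pauliCoeff_one_im {n : ℕ} (P : PauliString n) : (pauliCoeff P 1).im = 0 := by
  rw [← identity_matrix, pauliCoeff_matrix]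
  split_ifs <;> simp

theorem pauliCoeff_hamiltonian {n m : ℕ} {E : Fin m → PauliString n} (lam : Fin m → ℝ)
    (hE : Function.Injective E) (a : Fin m) :
    pauliCoeff (E a) (hamiltonian E lam) = lam a := by
  rw [hamiltonian, map_sum, Finset.sum_eq_single a]
  · simp [pauliCoeff_matrix]
  · intro b _ hb
    simp [pauliCoeff_matrix, hE.ne hb.symm]
  · simp

theorem sum_vecMulVec_choiVec (n : ℕ) :
    ∑ P : PauliString n, vecMulVec (choiVec P.matrix) (star (choiVec P.matrix)) = 1 := by
  ext ⟨s, r⟩ ⟨s', r'⟩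
  have h : ∀ P : PauliString n,
      vecMulVec (choiVec P.matrix) (star (choiVec P.matrix)) (s, r) (s', r') =
      (P.matrix s r * star (P.matrix s' r')) * (1 / 2 ^ n) := by
    intro P
    rw [vecMulVec_apply, Pi.star_apply, choiVec_apply, choiVec_apply, star_mul', ← sqrt_weight]
    simp only [Complex.star_def, Complex.conj_ofReal]
    ring
  rw [Matrix.sum_apply]
  simp only [h]
  rw [← Finset.sum_mul, sum_pauliString, one_apply]
  by_cases hs : s = s' ∧ r = r'
  · simp [hs]
  · rw [if_neg hs, if_neg (fun h => hs (Prod.ext_iff.1 h)), zero_mul]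

/-- Born's rule for a rank-one effect. -/
theorem re_dotProduct_vecMulVec {ι : Type} [Fintype ι] (b v : ι → ℂ) :
    (star v ⬝ᵥ (vecMulVec b (star b)).mulVec v).re = ‖star b ⬝ᵥ v‖ ^ 2 := by
  have h : star v ⬝ᵥ (vecMulVec b (star b)).mulVec v =
      star (star b ⬝ᵥ v) * (star b ⬝ᵥ v) := by
    rw [vecMulVec_mulVec, dotProduct_smul, star_dotProduct v b, MulOpposite.smul_eq_mul_unop,
      MulOpposite.unop_op]
  rw [h, Complex.star_def, ← Complex.normSq_eq_conj_mul_self, Complex.ofReal_re,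
    Complex.normSq_eq_norm_sq]

theorem sum_norm_sq_pauliCoeff {n : ℕ} (A : Matrix (Bits n) (Bits n) ℂ) :
    ∑ P : PauliString n, ‖pauliCoeff P A‖ ^ 2 = (star (choiVec A) ⬝ᵥ choiVec A).re := by
  simp only [pauliCoeff_apply, ← re_dotProduct_vecMulVec]
  rw [← Complex.re_sum, ← dotProduct_sum, ← sum_mulVec, sum_vecMulVec_choiVec, one_mulVec]

theorem sum_norm_sq_col_le {n : ℕ} (A : Matrix (Bits n) (Bits n) ℂ) (r : Bits n) :
    ∑ s, ‖A s r‖ ^ 2 ≤ opNorm A ^ 2 := by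
  have h := (toEuclideanCLM (𝕜 := ℂ) A).le_opNorm (EuclideanSpace.single r (1 : ℂ))
  rw [PiLp.norm_single, norm_one, mul_one] at h
  have h2 := pow_le_pow_left₀ (norm_nonneg _) h 2
  rw [EuclideanSpace.norm_sq_eq] at h2
  simpa [ofLp_toEuclideanCLM, opNorm] using h2

/-- By Parseval the left side is the average squared length of the columns of `A`, and each column
is the image of a unit vector. -/
theorem sum_norm_sq_pauliCoeff_le {n : ℕ} (A : Matrix (Bits n) (Bits n) ℂ) :
    ∑ P : PauliString n, ‖pauliCoeff P A‖ ^ 2 ≤ opNorm A ^ 2 := by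
  have h : (star (choiVec A) ⬝ᵥ choiVec A).re = (1 / 2 ^ n) * ∑ r, ∑ s, ‖A s r‖ ^ 2 := by
    rw [dotProduct, Fintype.sum_prod_type_right, Complex.re_sum, Finset.mul_sum]
    refine Finset.sum_congr rfl fun r _ => ?_
    rw [Complex.re_sum, Finset.mul_sum]
    refine Finset.sum_congr rfl fun s _ => ?_
    rw [Pi.star_apply, Complex.star_def, ← Complex.normSq_eq_conj_mul_self, Complex.ofReal_re,
      Complex.normSq_eq_norm_sq, choiVec_apply, norm_mul, mul_pow, Complex.norm_real,
      Real.norm_of_nonneg (by positivity), div_pow, Real.sq_sqrt (by positivity)]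
    ring
  rw [sum_norm_sq_pauliCoeff, h]
  calc (1 / 2 ^ n : ℝ) * ∑ r, ∑ s, ‖A s r‖ ^ 2 ≤ (1 / 2 ^ n) * ∑ _r : Bits n, opNorm A ^ 2 := by
        gcongr with r
        exact sum_norm_sq_col_le A r
    _ = opNorm A ^ 2 := by simp

theorem norm_pauliCoeff_le {n : ℕ} (P : PauliString n) (A : Matrix (Bits n) (Bits n) ℂ) :
    ‖pauliCoeff P A‖ ≤ opNorm A := by
  refine abs_le_of_sq_le_sq' ?_ (norm_nonneg _) |>.2
  exact (Finset.single_le_sum (f := fun P => ‖pauliCoeff P A‖ ^ 2)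
    (fun _ _ => by positivity) (Finset.mem_univ P)).trans (sum_norm_sq_pauliCoeff_le A)

theorem Pauli.matrix_isHermitian (p : Pauli) : p.matrix.IsHermitian := by
  ext a b
  cases p <;> cases a <;> cases b <;> simp [Pauli.matrix]

theorem PauliString.matrix_isHermitian {n : ℕ} (P : PauliString n) : P.matrix.IsHermitian := by
  ext x y
  simp only [conjTranspose_apply, PauliString.matrix, of_apply, star_prod]
  exact Finset.prod_congr rfl fun i _ => (P i).matrix_isHermitian.apply _ _

theorem hamiltonian_isHermitian {n m : ℕ} (E : Fin m → PauliString n) (lam : Fin m → ℝ) :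
    (hamiltonian E lam).IsHermitian := by
  rw [IsHermitian, hamiltonian, conjTranspose_sum]
  refine Finset.sum_congr rfl fun a _ => ?_
  rw [conjTranspose_smul, (E a).matrix_isHermitian.eq, Complex.star_def, Complex.conj_ofReal]

theorem heavyTerms_finite {n m : ℕ} (E : Fin m → PauliString n) (lam : Fin m → ℝ) (ε : ℝ) :
    (heavyTerms E lam ε).Finite := Set.toFinite _

/-- Each heavy term contributes at least `ε ^ 2` to the Parseval sum. The resulting bound is
independent of `n` and `m`, which keeps the union bound cheap. -/
theorem ncard_heavyTerms_mul_le {n m : ℕ} {E : Fin m → PauliString n} (lam : Fin m → ℝ)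
    (hE : Function.Injective E) {ε : ℝ} (hε : 0 ≤ ε) :
    (heavyTerms E lam ε).ncard * ε ^ 2 ≤ opNorm (hamiltonian E lam) ^ 2 := by
  classical
  refine le_trans ?_ (sum_norm_sq_pauliCoeff_le _)
  rw [Set.ncard_eq_toFinset_card _ (heavyTerms_finite E lam ε), ← nsmul_eq_mul]
  refine (Finset.card_nsmul_le_sum _ (fun P => ‖pauliCoeff P (hamiltonian E lam)‖ ^ 2) _ ?_).trans
    (Finset.sum_le_univ_sum_of_nonneg fun P => by positivity)
  intro P hP
  obtain ⟨a, rfl, ha⟩ := (heavyTerms_finite E lam ε).mem_toFinset.1 hP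
  rw [pauliCoeff_hamiltonian lam hE, Complex.norm_real, Real.norm_eq_abs]
  exact pow_le_pow_left₀ hε ha.le 2

theorem heavyTerms_eq_empty {n m : ℕ} {E : Fin m → PauliString n} (lam : Fin m → ℝ)
    (hE : Function.Injective E) {ε : ℝ} (h : opNorm (hamiltonian E lam) ≤ ε) :
    heavyTerms E lam ε = ∅ := by
  refine Set.eq_empty_of_forall_notMem ?_
  rintro _ ⟨a, rfl, ha⟩
  have := (norm_pauliCoeff_le (E a) _).trans h
  rw [pauliCoeff_hamiltonian lam hE, Complex.norm_real, Real.norm_eq_abs] at this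
  exact absurd ha this.not_gt

/-! ### Spectral calculus and unitarity of the evolution -/

open scoped Matrix.Norms.L2Operator in
/-- A functional calculus for a Hermitian matrix `H`, in which a function on the spectrum is given
by its values at the eigenvalues `h`. -/
theorem exists_diagonalization {n : ℕ} {H : Matrix (Bits n) (Bits n) ℂ} (hH : H.IsHermitian) :
    ∃ (ψ : (Bits n → ℂ) →ₐ[ℂ] Matrix (Bits n) (Bits n) ℂ) (h : Bits n → ℝ),
      (∀ d, opNorm (ψ d) = ‖d‖) ∧ H = ψ (fun i => h i) ∧
      ∀ t : ℝ, evolution H t = ψ (fun i => Complex.exp (-Complex.I * t * h i)) := by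
  let φ := Unitary.conjStarAlgAut ℂ (Matrix (Bits n) (Bits n) ℂ) hH.eigenvectorUnitary
  let ψ : (Bits n → ℂ) →ₐ[ℂ] Matrix (Bits n) (Bits n) ℂ :=
    (φ.toAlgEquiv : Matrix (Bits n) (Bits n) ℂ →ₐ[ℂ] Matrix (Bits n) (Bits n) ℂ).comp
      (diagonalAlgHom ℂ)
  have hψ : ∀ d, ψ d = φ (diagonal d) := fun d => rfl
  have hHψ : H = ψ (fun i => hH.eigenvalues i) := hH.spectral_theorem
  have hc : Continuous ψ := ψ.toLinearMap.continuous_of_finiteDimensional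
  refine ⟨ψ, hH.eigenvalues, fun d => ?_, hHψ, fun t => ?_⟩
  · rw [opNorm, l2_opNorm_toEuclideanCLM, hψ, Unitary.conjStarAlgAut_apply,
      CStarRing.norm_mul_mem_unitary _ (Unitary.star_mem hH.eigenvectorUnitary.2),
      CStarRing.norm_mem_unitary_mul _ hH.eigenvectorUnitary.2, l2_opNorm_diagonal]
  · conv_lhs => rw [evolution, hHψ, ← map_smul]
    -- A continuous algebra homomorphism commutes with the exponential, which is pointwise on
    -- functions of the eigenvalues.
    rw [← NormedSpace.map_exp ψ hc]
    congr 1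
    ext i
    rw [Pi.coe_exp, Complex.exp_eq_exp_ℂ]
    simp

open scoped Matrix.Norms.L2Operator in
theorem evolution_unitary {n : ℕ} {H : Matrix (Bits n) (Bits n) ℂ} (hH : H.IsHermitian) (t : ℝ) :
    evolution H t ∈ unitary (Matrix (Bits n) (Bits n) ℂ) := by
  let _ : NormedAlgebra ℚ (Matrix (Bits n) (Bits n) ℂ) := NormedAlgebra.restrictScalars ℚ ℂ _
  refine NormedSpace.exp_mem_unitary_of_mem_skewAdjoint ?_
  rw [skewAdjoint.mem_iff, star_eq_conjTranspose, conjTranspose_smul, hH.eq]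
  simp

theorem evolution_zero {n : ℕ} (H : Matrix (Bits n) (Bits n) ℂ) : evolution H 0 = 1 := by
  simp [evolution]

theorem evolution_natCast_mul {n : ℕ} (H : Matrix (Bits n) (Bits n) ℂ) (j : ℕ) (t : ℝ) :
    evolution H (j * t) = evolution H t ^ j := by
  rw [evolution, evolution, ← exp_nsmul, ← Nat.cast_smul_eq_nsmul ℂ, smul_smul]
  congr 2
  push_cast
  ring

/-! ### Outcome distributions and the union bound -/

section Experiments

variable {n : ℕ} {α Ω : Type} [Fintype α] [DecidableEq α] [Fintype Ω]

/-- The control projector and its complement are orthogonal, so the cross terms of the product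
vanish and the two blocks are unitary separately. -/
theorem Query.gate_unitary (q : Query α) {H : Matrix (Bits n) (Bits n) ℂ} (hH : H.IsHermitian) :
    q.gate H ∈ unitary (Matrix (Joint n α) (Joint n α) ℂ) := by
  have hP : q.projector * q.projector = q.projector := by
    rw [Query.projector, diagonal_mul_diagonal]
    congr 1
    ext x
    split_ifs <;> simp
  have hPs : q.projectorᴴ = q.projector := by
    rw [Query.projector, diagonal_conjTranspose]
    congr 1
    ext x
    simp only [Pi.star_apply]
    split_ifs <;> simp
  have hV := Unitary.mul_star_self_of_mem (evolution_unitary hH q.time)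
  rw [star_eq_conjTranspose] at hV
  refine mem_unitaryGroup_iff.2 ?_
  rw [star_eq_conjTranspose, Query.gate, conjTranspose_add, conjTranspose_kronecker,
    conjTranspose_kronecker, conjTranspose_sub, conjTranspose_one, hPs, conjTranspose_one,
    add_mul, mul_add, mul_add, ← mul_kronecker_mul, ← mul_kronecker_mul, ← mul_kronecker_mul,
    ← mul_kronecker_mul, hV]
  simp only [mul_sub, sub_mul, mul_one, one_mul, hP, sub_self, zero_kronecker, add_zero, zero_add,
    sub_zero]
  rw [← add_kronecker, add_sub_cancel, one_kronecker_one]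

theorem ControlCircuit.eval_unitary (C : ControlCircuit n α) {H : Matrix (Bits n) (Bits n) ℂ}
    (hH : H.IsHermitian) : C.eval H ∈ unitary (Matrix (Joint n α) (Joint n α) ℂ) := by
  refine List.foldlRecOn (motive := fun W => W ∈ unitary (Matrix (Joint n α) (Joint n α) ℂ))
    C.steps _ C.first.2 fun W hW s _ => ?_
  exact mul_mem (mul_mem s.2.2 (s.1.gate_unitary hH)) hW

theorem Experiment.prob_nonneg (e : Experiment n α Ω) (H : Matrix (Bits n) (Bits n) ℂ) (ω : Ω) :
    0 ≤ e.prob H ω :=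
  (Complex.nonneg_iff.1 ((e.effect_pos ω).dotProduct_mulVec_nonneg (e.final H))).1

theorem Experiment.sum_prob (e : Experiment n α Ω) {H : Matrix (Bits n) (Bits n) ℂ}
    (hH : H.IsHermitian) : ∑ ω, e.prob H ω = 1 := by
  have h := Unitary.star_mul_self_of_mem (e.circuit.eval_unitary hH)
  rw [star_eq_conjTranspose] at h
  simp only [Experiment.prob]
  rw [← Complex.re_sum, ← dotProduct_sum, ← sum_mulVec, e.effect_sum, one_mulVec,
    Experiment.final, star_mulVec, ← dotProduct_mulVec, mulVec_mulVec, h, one_mulVec, e.init_norm,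
    Complex.one_re]

/-- A union bound: if every element `P` of `S` is returned as soon as one of the experiments has
the outcome `o P`, which has probability at least `p` each time, then it is unlikely that an
element of `S` is missed. -/
theorem Learner.successProb_ge (L : Learner n α Ω) {H : Matrix (Bits n) (Bits n) ℂ}
    (hH : H.IsHermitian) (S : Set (PauliString n)) (o : PauliString n → Ω) {p : ℝ}
    (ho : ∀ P ∈ S, ∀ ω i, ω i = o P → P ∈ L.output ω)
    (hp : ∀ P ∈ S, ∀ i, p ≤ (L.experiment i).prob H (o P)) :
    1 - S.ncard * (1 - p) ^ L.count ≤ L.successProb H S := by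
  classical
  set pr : (Fin L.count → Ω) → ℝ := fun ω => ∏ i, (L.experiment i).prob H (ω i) with hpr
  have hpr0 : ∀ ω, 0 ≤ pr ω := fun ω =>
    Finset.prod_nonneg fun i _ => (L.experiment i).prob_nonneg H _
  have htotal : ∑ ω, pr ω = 1 := by
    rw [hpr, ← Fintype.prod_sum]
    exact Finset.prod_eq_one fun i _ => (L.experiment i).sum_prob hH
  have hmiss : ∀ P ∈ S, ∑ ω, (if P ∈ L.output ω then 0 else pr ω) ≤ (1 - p) ^ L.count := by
    intro P hP
    -- Missing `P` forces every experiment to avoid the outcome `o P`. By independence the sum over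
    -- outcome tuples factorises, and each factor is at most `1 - p`.
    calc ∑ ω, (if P ∈ L.output ω then 0 else pr ω)
        ≤ ∑ ω : Fin L.count → Ω, ∏ i, (if ω i = o P then 0 else (L.experiment i).prob H (ω i)) := by
          refine Finset.sum_le_sum fun ω _ => ?_
          split_ifs with h
          · refine Finset.prod_nonneg fun i _ => ?_
            split_ifs
            exacts [le_rfl, (L.experiment i).prob_nonneg H _]
          · refine (Finset.prod_congr rfl fun i _ => ?_).le
            rw [if_neg fun hi => h (ho P hP ω i hi)]
      _ = ∏ i, ∑ x, (if x = o P then 0 else (L.experiment i).prob H x) :=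
          (Fintype.prod_sum fun i x => if x = o P then 0 else (L.experiment i).prob H x).symm
      _ ≤ ∏ _i : Fin L.count, (1 - p) := by
          refine Finset.prod_le_prod (fun i _ => Finset.sum_nonneg fun x _ => ?_) fun i _ => ?_
          · split_ifs
            exacts [le_rfl, (L.experiment i).prob_nonneg H _]
          · have h1 := (L.experiment i).sum_prob hH
            rw [← Finset.add_sum_erase _ _ (Finset.mem_univ (o P))] at h1
            rw [← Finset.add_sum_erase _ _ (Finset.mem_univ (o P)), if_pos rfl, zero_add,
              Finset.sum_congr rfl fun x hx => if_neg (Finset.ne_of_mem_erase hx)]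
            linarith [hp P hP i]
      _ = (1 - p) ^ L.count := by simp
  have hS : S.Finite := Set.toFinite S
  have hfail : ∑ ω, (if S ⊆ (L.output ω : Set (PauliString n)) then 0 else pr ω) ≤
      S.ncard * (1 - p) ^ L.count := by
    calc ∑ ω, (if S ⊆ (L.output ω : Set (PauliString n)) then 0 else pr ω)
        ≤ ∑ ω, ∑ P ∈ hS.toFinset, (if P ∈ L.output ω then 0 else pr ω) := by
          have hterm : ∀ ω P, 0 ≤ (if P ∈ L.output ω then 0 else pr ω) := by
            intro ω P
            split_ifs
            exacts [le_rfl, hpr0 ω]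
          refine Finset.sum_le_sum fun ω _ => ?_
          split_ifs with h
          · exact Finset.sum_nonneg fun P _ => hterm ω P
          · obtain ⟨P, hP, hPo⟩ := Set.not_subset.1 h
            refine le_trans ?_ (Finset.single_le_sum (fun P _ => hterm ω P)
              (hS.mem_toFinset.2 hP))
            rw [if_neg (Finset.mem_coe.not.1 hPo)]
      _ = ∑ P ∈ hS.toFinset, ∑ ω, (if P ∈ L.output ω then 0 else pr ω) := Finset.sum_comm
      _ ≤ ∑ _P ∈ hS.toFinset, (1 - p) ^ L.count :=
          Finset.sum_le_sum fun P hP => hmiss P (hS.mem_toFinset.1 hP)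
      _ = S.ncard * (1 - p) ^ L.count := by
          rw [Finset.sum_const, nsmul_eq_mul, Set.ncard_eq_toFinset_card S hS]
  have hsplit : L.successProb H S +
      ∑ ω, (if S ⊆ (L.output ω : Set (PauliString n)) then 0 else pr ω) = 1 := by
    rw [← htotal, Learner.successProb, ← Finset.sum_add_distrib]
    refine Finset.sum_congr rfl fun ω _ => ?_
    split_ifs <;> simp [hpr]
  linarith

end Experiments

/-! ### Number of repetitions and the common reduction -/

/-- The number of Bell measurements that suffice for the accuracy `1 / R` relative to `Δ`. -/
noncomputable def repetitions (R δ : ℝ) : ℕ :=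
  if R ≤ 2 then 0 else ⌈64 * R ^ 4 * (2 * Real.log R + Real.log (1 / δ))⌉₊

/-- Here `s` stands for the number of heavy terms. From (1 - p)^N ≤ exp(-Np), the term 2 log R in
the repetition count pays for the factor R² and log(1/δ) for the failure probability. -/
theorem mul_pow_repetitions_le {R δ p s : ℝ} (hR : 2 < R) (hδ : 0 < δ)
    (hs : s ≤ R ^ 2) (hp : 1 / (64 * R ^ 4) ≤ p) (hp1 : p ≤ 1) :
    s * (1 - p) ^ repetitions R δ ≤ δ := by
  have hR0 : 0 < R := by linarith
  rw [repetitions, if_neg hR.not_ge]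
  set N := ⌈64 * R ^ 4 * (2 * Real.log R + Real.log (1 / δ))⌉₊
  have hN : 2 * Real.log R + Real.log (1 / δ) ≤ N * p := by
    have h1 : 64 * R ^ 4 * (2 * Real.log R + Real.log (1 / δ)) ≤ N := Nat.le_ceil _
    have h2 : 2 * Real.log R + Real.log (1 / δ) ≤ N * (1 / (64 * R ^ 4)) := by
      rw [mul_one_div, le_div_iff₀ (by positivity)]
      linarith
    exact h2.trans (mul_le_mul_of_nonneg_left hp (Nat.cast_nonneg N))
  have h3 : (1 - p) ^ N ≤ Real.exp (-(2 * Real.log R + Real.log (1 / δ))) := by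
    calc (1 - p) ^ N ≤ Real.exp (-p) ^ N :=
          pow_le_pow_left₀ (by linarith) (Real.one_sub_le_exp_neg p) N
      _ = Real.exp (-(N * p)) := by rw [← Real.exp_nat_mul]; ring_nf
      _ ≤ _ := Real.exp_le_exp.2 (by linarith)
  have h4 : Real.exp (-(2 * Real.log R + Real.log (1 / δ))) = δ / R ^ 2 := by
    rw [one_div, Real.log_inv, neg_add, neg_neg, Real.exp_add, Real.exp_log hδ, Real.exp_neg,
      two_mul, Real.exp_add, Real.exp_log hR0]
    ring
  rw [h4] at h3
  calc s * (1 - p) ^ N ≤ R ^ 2 * (δ / R ^ 2) :=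
        mul_le_mul hs h3 (pow_nonneg (by linarith) _) (by positivity)
    _ = δ := by field_simp

/-- As 2 + R ≥ 3 > e, constants and lower powers can be absorbed into powers of this logarithm. -/
theorem one_le_log_two_add {R : ℝ} (hR : 1 ≤ R) : 1 ≤ Real.log (2 + R) := by
  rw [Real.le_log_iff_exp_le (by linarith)]
  linarith [Real.exp_one_lt_d9]

/-- The constant is 129 = 2 · 64 + 1, with the 1 paying for the rounding up. -/
theorem repetitions_le {R δ : ℝ} (hR : 2 < R) (hδ : 0 < δ) (hδ1 : δ < 1) :
    (repetitions R δ : ℝ) ≤ 129 * R ^ 4 * Real.log (2 + R) * (1 + Real.log (1 / δ)) := by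
  have hD : 0 ≤ Real.log (1 / δ) := Real.log_nonneg (by rw [le_div_iff₀ hδ]; linarith)
  have hl := one_le_log_two_add (R := R) (by linarith)
  have hlR : Real.log R ≤ Real.log (2 + R) := Real.log_le_log (by linarith) (by linarith)
  have hlR0 : 0 ≤ Real.log R := Real.log_nonneg (by linarith)
  have hR4 : 1 ≤ R ^ 4 := one_le_pow₀ (by linarith)
  rw [repetitions, if_neg hR.not_ge]
  refine (Nat.ceil_lt_add_one (by positivity)).le.trans ?_
  set l := Real.log (2 + R)
  set D := Real.log (1 / δ)
  have hlD : 1 ≤ l * (1 + D) := by nlinarith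
  have h1 : 2 * Real.log R + D ≤ 2 * (l * (1 + D)) := by nlinarith
  have h2 : 64 * R ^ 4 * (2 * Real.log R + D) ≤ 64 * R ^ 4 * (2 * (l * (1 + D))) :=
    mul_le_mul_of_nonneg_left h1 (by positivity)
  have h3 : 1 ≤ R ^ 4 * (l * (1 + D)) := by nlinarith
  linarith

/-- A learner which returns every Pauli operator `P` for which one of the experiments had the
outcome `o P` learns the structure if these outcomes are sufficiently likely. -/
theorem Learner.learnsStructure {n : ℕ} {α Ω : Type} [Fintype α] [DecidableEq α] [Fintype Ω]
    (L : Learner n α Ω) {Δ : ℝ≥0} {ε δ : ℝ} (hΔ : 0 < Δ) (hε : 0 < ε) (hδ : 0 < δ)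
    (hcard : ∀ ω, (L.output ω).card ≤ L.queries) (hcount : L.count = repetitions (Δ / ε) δ)
    (o : PauliString n → Ω) (ho : ∀ P ω i, ω i = o P → P ∈ L.output ω)
    (hp : 2 < Δ / ε → ∀ H : Matrix (Bits n) (Bits n) ℂ, H.IsHermitian → 2 * opNorm H ≤ Δ →
      ∀ P, (pauliCoeff P H).im = 0 → ε < ‖pauliCoeff P H‖ → ∀ i,
        1 / (64 * (Δ / ε) ^ 4) ≤ (L.experiment i).prob H (o P)) :
    L.LearnsStructure Δ ε δ := by
  refine ⟨hcard, fun m E lam hE hH => ?_⟩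
  have hherm := hamiltonian_isHermitian E lam
  rcases le_or_gt ((Δ : ℝ) / ε) 2 with hR | hR
  · rw [div_le_iff₀ hε] at hR
    rw [heavyTerms_eq_empty lam hE (by linarith)]
    -- With no heavy term the union bound over the empty set gives success probability 1, even
    -- without experiments.
    have := L.successProb_ge hherm ∅ o (p := 0) (by simp) (by simp)
    simp only [Set.ncard_empty, Nat.cast_zero, zero_mul] at this
    linarith
  · have hp' : ∀ P ∈ heavyTerms E lam ε, ∀ i,
        1 / (64 * (Δ / ε) ^ 4) ≤ (L.experiment i).prob (hamiltonian E lam) (o P) := by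
      rintro _ ⟨a, rfl, ha⟩
      refine hp hR _ hherm hH _ ?_ ?_
      · rw [pauliCoeff_hamiltonian lam hE, Complex.ofReal_im]
      · rwa [pauliCoeff_hamiltonian lam hE, Complex.norm_real, Real.norm_eq_abs]
    refine le_trans ?_ (L.successProb_ge hherm _ o (fun P _ => ho P) hp')
    rw [hcount]
    refine sub_le_sub_left (mul_pow_repetitions_le hR hδ ?_ le_rfl ?_) 1
    · have h0 : 0 ≤ opNorm (hamiltonian E lam) := norm_nonneg _
      have h1 := ncard_heavyTerms_mul_le lam hE hε.le
      have h2 : opNorm (hamiltonian E lam) ^ 2 ≤ (Δ : ℝ) ^ 2 :=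
        pow_le_pow_left₀ h0 (by linarith) 2
      rw [div_pow, le_div_iff₀ (by positivity)]
      exact h1.trans h2
    · have : 1 ≤ ((Δ : ℝ) / ε) ^ 4 := one_le_pow₀ (by linarith)
      rw [div_le_one (by positivity)]
      linarith

/-- The cost bound for a learner with `repetitions` experiments, each of which makes at most
`3 log (2 + Δ / ε)` queries and uses at most `9 log (2 + Δ / ε)² / Δ` evolution time. -/
theorem Learner.costBound {n : ℕ} {α Ω : Type} [Fintype α] [DecidableEq α] [Fintype Ω]
    (L : Learner n α Ω) {Δ : ℝ≥0} {ε δ : ℝ} (hΔ : 0 < Δ) (hε : 0 < ε) (hδ : 0 < δ) (hδ1 : δ < 1)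
    (hcount : L.count = repetitions (Δ / ε) δ)
    (hq : 2 < Δ / ε → ∀ i, ((L.experiment i).circuit.queries : ℝ) ≤ 3 * Real.log (2 + Δ / ε))
    (ht : 2 < Δ / ε → ∀ i, ((L.experiment i).circuit.time : ℝ) ≤
      9 * Real.log (2 + Δ / ε) ^ 2 / Δ) :
    L.CostBound 1161 3 Δ ε δ := by
  have hΔ' : (0 : ℝ) < Δ := hΔ
  have hD : 0 ≤ Real.log (1 / δ) := Real.log_nonneg (by rw [le_div_iff₀ hδ]; linarith)
  have hlog : 0 ≤ Real.log (2 + Δ / ε) := by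
    refine Real.log_nonneg ?_
    have : 0 ≤ (Δ : ℝ) / ε := by positivity
    linarith
  rcases le_or_gt ((Δ : ℝ) / ε) 2 with hR | hR
  · have h0 : L.count = 0 := by rw [hcount, repetitions, if_pos hR]
    have : IsEmpty (Fin L.count) := by rw [h0]; infer_instance
    constructor
    · rw [Learner.queries, Finset.univ_eq_empty, Finset.sum_empty, Nat.cast_zero]
      positivity
    · rw [Learner.time, Finset.univ_eq_empty, Finset.sum_empty, NNReal.coe_zero]
      positivity
  · have hN := repetitions_le hR hδ hδ1
    have hl := one_le_log_two_add (R := Δ / ε) (by linarith)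
    rw [← hcount] at hN
    set l := Real.log (2 + Δ / ε)
    set D := Real.log (1 / δ)
    constructor
    · calc (L.queries : ℝ) = ∑ i, ((L.experiment i).circuit.queries : ℝ) := by
            rw [Learner.queries, Nat.cast_sum]
        _ ≤ ∑ _i : Fin L.count, 3 * l := Finset.sum_le_sum fun i _ => hq hR i
        _ = L.count * (3 * l) := by simp
        _ ≤ (129 * (Δ / ε) ^ 4 * l * (1 + D)) * (3 * l) := by gcongr
        _ = 387 * (Δ / ε) ^ 4 * l ^ 2 * (1 + D) := by ring
        -- Only `l ^ 2` and 387 = 3 · 129 are needed here; they are weakened to the exponent and the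
        -- constant 1161 = 9 · 129 of the time bound.
        _ ≤ 1161 * (Δ / ε) ^ 4 * l ^ 3 * (1 + D) := by
            gcongr
            · norm_num
            · norm_num
        _ = _ := by rw [div_pow]
    · calc (L.time : ℝ) = ∑ i, ((L.experiment i).circuit.time : ℝ) := by
            rw [Learner.time, NNReal.coe_sum]
        _ ≤ ∑ _i : Fin L.count, 9 * l ^ 2 / Δ := Finset.sum_le_sum fun i _ => ht hR i
        _ = L.count * (9 * l ^ 2 / Δ) := by simp
        _ ≤ (129 * (Δ / ε) ^ 4 * l * (1 + D)) * (9 * l ^ 2 / Δ) := by gcongr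
        _ = 1161 * ((Δ : ℝ) ^ 3 / ε ^ 4) * l ^ 3 * (1 + D) := by field_simp; ring

/-! ### Pauli coefficients of functions of the Hamiltonian -/

/-- First-order Taylor expansion: the imaginary part of the coefficient of 1 - itH has absolute
value exactly t times that of `H`, and the remainder is bounded eigenvalue by eigenvalue. -/
theorem norm_pauliCoeff_evolution_ge {n : ℕ} {H : Matrix (Bits n) (Bits n) ℂ}
    (hH : H.IsHermitian) (P : PauliString n) (him : (pauliCoeff P H).im = 0) {t : ℝ} (ht : 0 ≤ t)
    (htH : t * opNorm H ≤ 1) :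
    t * ‖pauliCoeff P H‖ - (t * opNorm H) ^ 2 ≤ ‖pauliCoeff P (evolution H t)‖ := by
  obtain ⟨ψ, h, hψ, hHψ, hev⟩ := exists_diagonalization hH
  have hnorm : ∀ i, ‖-Complex.I * t * h i‖ ≤ t * opNorm H := by
    intro i
    rw [norm_mul, norm_mul, norm_neg, Complex.norm_I, one_mul, Complex.norm_real,
      Real.norm_of_nonneg ht]
    refine mul_le_mul_of_nonneg_left ?_ ht
    conv_rhs => rw [hHψ, hψ]
    exact norm_le_pi_norm (fun i => (h i : ℂ)) i
  have herr : opNorm (evolution H t - (1 - (Complex.I * t) • H)) ≤ (t * opNorm H) ^ 2 := by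
    have h1 : evolution H t - (1 - (Complex.I * t) • H) =
        ψ (fun i => Complex.exp (-Complex.I * t * h i) - 1 - -Complex.I * t * h i) := by
      conv_lhs => rw [hev, hHψ, ← map_smul, ← map_one ψ, ← map_sub, ← map_sub]
      congr 1
      ext i
      simp only [Pi.sub_apply, Pi.one_apply, Pi.smul_apply, smul_eq_mul]
      ring
    rw [h1, hψ]
    refine (pi_norm_le_iff_of_nonneg (by positivity)).2 fun i => ?_
    exact (Complex.norm_exp_sub_one_sub_id_le ((hnorm i).trans htH)).trans
      (pow_le_pow_left₀ (norm_nonneg _) (hnorm i) 2)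
  have h2 := (norm_pauliCoeff_le P _).trans herr
  have h3 : t * ‖pauliCoeff P H‖ ≤ ‖pauliCoeff P (1 - (Complex.I * t) • H)‖ := by
    have h4 : pauliCoeff P H = ((pauliCoeff P H).re : ℂ) := by
      apply Complex.ext <;> simp [him]
    have h5 : |(pauliCoeff P (1 - (Complex.I * t) • H)).im| = t * ‖pauliCoeff P H‖ := by
      rw [map_sub, map_smul, Complex.sub_im, pauliCoeff_one_im, h4, Complex.norm_real]
      simp [abs_mul, abs_of_nonneg ht]
    rw [← h5]
    exact Complex.abs_im_le_norm _
  rw [map_sub] at h2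
  have h6 := norm_sub_norm_le (pauliCoeff P (1 - (Complex.I * t) • H))
    (pauliCoeff P (evolution H t))
  rw [norm_sub_rev] at h6
  linarith

/-- With z = exp(-iθ) - 1, |z| ≤ |θ| ≤ 1/2, and log(1 + z) = -iθ on the principal branch. In the
Taylor remainder |z|^(K+1) / ((1 - |z|)(K + 1)) the factor 1/(1 - |z|) ≤ 2 is cancelled by K + 1 ≥
2. -/
theorem norm_log_series_sub_le {K : ℕ} (hK : 1 ≤ K) {θ : ℝ} (hθ : |θ| ≤ 1 / 2) :
    ‖Complex.I * ∑ k ∈ Finset.Icc 1 K,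
      ((-1 : ℂ) ^ (k + 1) / (k : ℂ)) * (Complex.exp (-Complex.I * θ) - 1) ^ k - θ‖ ≤
      (1 / 2) ^ (K + 1) := by
  set z := Complex.exp (-Complex.I * θ) - 1 with hz
  have hznorm : ‖z‖ ≤ 1 / 2 := by
    have := Real.norm_exp_I_mul_ofReal_sub_one_le (x := -θ)
    rw [Complex.ofReal_neg, mul_neg, ← neg_mul, norm_neg, Real.norm_eq_abs] at this
    exact this.trans hθ
  have hlog : Complex.log (1 + z) = -Complex.I * θ := by
    have hpi := Real.pi_gt_three
    obtain ⟨h1, h2⟩ := abs_le.1 hθ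
    rw [hz, add_sub_cancel]
    refine Complex.log_exp ?_ ?_ <;> simp <;> linarith
  have htaylor : ∑ k ∈ Finset.Icc 1 K, ((-1 : ℂ) ^ (k + 1) / (k : ℂ)) * z ^ k =
      Complex.logTaylor (K + 1) z := by
    rw [Complex.logTaylor, Finset.sum_range_succ', ← Finset.Ico_succ_right_eq_Icc,
      Finset.sum_Ico_eq_sum_range]
    simp only [Nat.cast_zero, div_zero, add_zero]
    refine Finset.sum_congr (by simp) fun k _ => ?_
    rw [add_comm 1 k]
    ring
  have h := Complex.norm_log_sub_logTaylor_le K (z := z) (by linarith)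
  rw [hlog] at h
  have h2 : Complex.I * Complex.logTaylor (K + 1) z - θ =
      -Complex.I * (-Complex.I * θ - Complex.logTaylor (K + 1) z) := by
    linear_combination (-(θ : ℂ)) * Complex.I_sq
  rw [htaylor, h2, norm_mul, norm_neg, Complex.norm_I, one_mul]
  refine h.trans ?_
  have h3 : (1 - ‖z‖)⁻¹ ≤ 2 := by
    rw [inv_le_comm₀ (by linarith) (by norm_num)]
    linarith
  have hK' : (2 : ℝ) ≤ K + 1 := by exact_mod_cast Nat.succ_le_succ hK
  calc ‖z‖ ^ (K + 1) * (1 - ‖z‖)⁻¹ / (K + 1) ≤ (1 / 2) ^ (K + 1) * 2 / 2 := by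
        have : 0 ≤ (1 - ‖z‖)⁻¹ := inv_nonneg.2 (by linarith)
        gcongr
    _ = _ := by ring

/-- The scalar estimate, applied to the eigenvalues of `t • H`, bounds the operator-norm distance of
i L_K(U) from tH. No reality of the coefficient is needed, since there is no identity term to cancel
against. -/
theorem norm_pauliCoeff_logPartial_ge {n : ℕ} {H : Matrix (Bits n) (Bits n) ℂ}
    (hH : H.IsHermitian) (P : PauliString n) {K : ℕ} (hK : 1 ≤ K) {t : ℝ} (ht : 0 ≤ t)
    (htH : t * opNorm H ≤ 1 / 2) :
    t * ‖pauliCoeff P H‖ - (1 / 2) ^ (K + 1) ≤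
      ‖pauliCoeff P (Complex.I • logPartial K (evolution H t))‖ := by
  obtain ⟨ψ, h, hψ, hHψ, hev⟩ := exists_diagonalization hH
  have hnorm : ∀ i, |t * h i| ≤ 1 / 2 := by
    intro i
    rw [abs_mul, abs_of_nonneg ht]
    refine le_trans (mul_le_mul_of_nonneg_left ?_ ht) htH
    conv_rhs => rw [hHψ, hψ]
    have := norm_le_pi_norm (fun i => (h i : ℂ)) i
    rwa [Complex.norm_real, Real.norm_eq_abs] at this
  have herr : opNorm (Complex.I • logPartial K (evolution H t) - (t : ℂ) • H) ≤
      (1 / 2) ^ (K + 1) := by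
    have h1 : Complex.I • logPartial K (evolution H t) - (t : ℂ) • H =
        ψ (fun i => Complex.I * ∑ k ∈ Finset.Icc 1 K, ((-1 : ℂ) ^ (k + 1) / (k : ℂ)) *
          (Complex.exp (-Complex.I * (t * h i : ℝ)) - 1) ^ k - (t * h i : ℝ)) := by
      conv_lhs => rw [hev, hHψ, ← map_smul, logPartial, ← map_one ψ, ← map_sub]
      simp only [← map_pow, ← map_smul, ← map_sum, ← map_sub]
      congr 1
      ext i
      simp [mul_assoc]
    rw [h1, hψ]
    exact (pi_norm_le_iff_of_nonneg (by positivity)).2 fun i => norm_log_series_sub_le hK (hnorm i)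
  have h2 := (norm_pauliCoeff_le P _).trans herr
  rw [map_sub, map_smul (pauliCoeff P) (t : ℂ)] at h2
  have h6 := norm_sub_norm_le ((t : ℂ) • pauliCoeff P H)
    (pauliCoeff P (Complex.I • logPartial K (evolution H t)))
  rw [norm_sub_rev, norm_smul, Complex.norm_real, Real.norm_of_nonneg ht] at h6
  linarith

/-! ### The action of queries on states -/

/-- The gate is block diagonal in the computational basis of the ancillas. -/
theorem Query.gate_mulVec_apply {n : ℕ} {α : Type} [Fintype α] [DecidableEq α] (q : Query α)
    (H : Matrix (Bits n) (Bits n) ℂ) (v : Joint n α → ℂ) (x : α → Bool) (s : Bits n) :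
    (q.gate H).mulVec v (x, s) =
      if ∀ i b, q.control i = some b → x i = b then
        ∑ s', evolution H q.time s s' * v (x, s') else v (x, s) := by
  rw [mulVec, dotProduct, Fintype.sum_prod_type, Finset.sum_eq_single x]
  · simp only [Query.gate, Matrix.add_apply, kroneckerMap_apply, Query.projector, diagonal_apply_eq,
      Matrix.sub_apply, one_apply_eq]
    split_ifs <;> simp [one_apply]
  · intro y _ hy
    refine Finset.sum_eq_zero fun s' _ => ?_
    simp [Query.gate, Query.projector, diagonal_apply_ne' _ hy, one_apply_ne' hy]
  · simp

theorem choiVec_mul_apply {n : ℕ} (A B : Matrix (Bits n) (Bits n) ℂ) (s r : Bits n) :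
    choiVec (A * B) (s, r) = ∑ s', A s s' * choiVec B (s', r) := by
  simp only [choiVec_apply, mul_apply, Finset.sum_mul, mul_assoc]

/-! ### Bell sampling of a short time evolution -/

theorem star_dotProduct_maxEnt (n : ℕ) : star (maxEnt n) ⬝ᵥ maxEnt n = 1 := by
  rw [← choiVec_one, ← identity_matrix, ← pauliCoeff_apply, pauliCoeff_matrix, if_pos rfl]

/-- Apply the time evolution to one half of the maximally entangled state, and measure in the
Bell basis. -/
noncomputable def bellExperiment (n : ℕ) (t : ℝ≥0) :
    Experiment n (Fin n) (Fin (Fintype.card (PauliString n))) where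
  -- The ancillas serve as the reference copy. `Joint` lists them first, whereas `maxEnt` lists the
  -- system first; hence the swap.
  init := maxEnt n ∘ Equiv.prodComm _ _
  init_norm := by
    rw [← star_dotProduct_maxEnt n]
    exact comp_equiv_dotProduct_comp_equiv (star (maxEnt n)) (maxEnt n) _
  circuit := ⟨1, [(⟨t, fun _ => none⟩, 1)]⟩
  -- Pauli strings are numbered so that the outcome type has the form `Fin w`.
  effect ω := vecMulVec
    (choiVec ((Fintype.equivFin (PauliString n)).symm ω).matrix ∘ Equiv.prodComm _ _)
    (star (choiVec ((Fintype.equivFin (PauliString n)).symm ω).matrix ∘ Equiv.prodComm _ _))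
  effect_pos ω := posSemidef_vecMulVec_self_star _
  effect_sum := by
    rw [(Fintype.equivFin (PauliString n)).symm.sum_comp fun P : PauliString n =>
      vecMulVec (choiVec P.matrix ∘ Equiv.prodComm _ _)
        (star (choiVec P.matrix ∘ Equiv.prodComm _ _))]
    have h := congrArg
      (fun M => M.submatrix (Equiv.prodComm (Bits n) (Bits n)) (Equiv.prodComm (Bits n) (Bits n)))
      (sum_vecMulVec_choiVec n)
    simp only [submatrix_one_equiv] at h
    rw [← h]
    ext p p'
    simp only [Matrix.sum_apply, submatrix_apply]
    rfl

theorem bellExperiment_final (n : ℕ) (t : ℝ≥0) (H : Matrix (Bits n) (Bits n) ℂ) :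
    (bellExperiment n t).final H = choiVec (evolution H t) ∘ Equiv.prodComm _ _ := by
  ext ⟨x, s⟩
  simp only [bellExperiment, Experiment.final, ControlCircuit.eval, List.foldl_cons,
    List.foldl_nil, OneMemClass.coe_one, one_mul, mul_one, Query.gate_mulVec_apply]
  rw [if_pos (by simp), Function.comp_apply, Equiv.prodComm_apply, Prod.swap_prod_mk,
    ← mul_one (evolution H t), choiVec_mul_apply, choiVec_one, mul_one]
  rfl

theorem bellExperiment_prob {n : ℕ} (t : ℝ≥0) (H : Matrix (Bits n) (Bits n) ℂ)
    (P : PauliString n) :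
    (bellExperiment n t).prob H (Fintype.equivFin _ P) = ‖pauliCoeff P (evolution H t)‖ ^ 2 := by
  rw [Experiment.prob, bellExperiment_final]
  simp only [bellExperiment, Equiv.symm_apply_apply]
  rw [re_dotProduct_vecMulVec, pauliCoeff_apply]
  congr 2
  exact comp_equiv_dotProduct_comp_equiv (star (choiVec P.matrix)) (choiVec (evolution H t)) _

/-- Return the outcomes of `N` Bell measurements of the time evolution. -/
noncomputable def bellLearner (n N : ℕ) (t : ℝ≥0) :
    Learner n (Fin n) (Fin (Fintype.card (PauliString n))) where
  count := N
  experiment _ := bellExperiment n t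
  output ω := Finset.univ.image fun i => (Fintype.equivFin (PauliString n)).symm (ω i)

theorem bellLearner_uncontrolled (n N : ℕ) (t : ℝ≥0) : (bellLearner n N t).Uncontrolled := by
  intro i s hs
  obtain rfl := List.mem_singleton.1 hs
  exact fun _ => rfl

theorem bellLearner_costBound (n : ℕ) {Δ : ℝ≥0} {ε δ : ℝ} (hΔ : 0 < Δ) (hε : 0 < ε) (hδ : 0 < δ)
    (hδ1 : δ < 1) :
    (bellLearner n (repetitions (Δ / ε) δ) (ε.toNNReal / Δ ^ 2)).CostBound 1161 3 Δ ε δ := by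
  have hΔ' : (0 : ℝ) < Δ := hΔ
  refine Learner.costBound _ hΔ hε hδ hδ1 rfl (fun hR i => ?_) (fun hR i => ?_)
  · have hl := one_le_log_two_add (R := Δ / ε) (by linarith)
    have : ((bellLearner n (repetitions (Δ / ε) δ) (ε.toNNReal / Δ ^ 2)).experiment i).circuit.queries
      = 1 := rfl
    rw [this, Nat.cast_one]
    linarith
  · have hl := one_le_log_two_add (R := Δ / ε) (by linarith)
    have : ((bellLearner n (repetitions (Δ / ε) δ) (ε.toNNReal / Δ ^ 2)).experiment i).circuit.time
      = ε.toNNReal / Δ ^ 2 := by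
        simp [bellLearner, bellExperiment, ControlCircuit.time]
    rw [this, NNReal.coe_div, NNReal.coe_pow, Real.coe_toNNReal _ hε.le]
    rw [lt_div_iff₀ hε] at hR
    have h1 : ε / (Δ : ℝ) ^ 2 ≤ 1 / Δ := by
      rw [div_le_div_iff₀ (by positivity) hΔ']
      nlinarith
    refine h1.trans ?_
    gcongr
    nlinarith

/-- The time t = ε/Δ² balances the two orders: the signal is at least tε = (ε/Δ)², while (t‖H‖)² ≤
(ε/Δ)²/4. -/
theorem bellLearner_learnsStructure (n : ℕ) {Δ : ℝ≥0} {ε δ : ℝ} (hΔ : 0 < Δ) (hε : 0 < ε)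
    (hδ : 0 < δ) :
    (bellLearner n (repetitions (Δ / ε) δ) (ε.toNNReal / Δ ^ 2)).LearnsStructure Δ ε δ := by
  have hΔ' : (0 : ℝ) < Δ := hΔ
  refine Learner.learnsStructure _ hΔ hε hδ (fun ω => ?_) rfl
    (fun P => Fintype.equivFin (PauliString n) P) (fun P ω i hi => ?_) fun hR H hH hHΔ P him hP i => ?_
  · have hq : (bellLearner n (repetitions (Δ / ε) δ) (ε.toNNReal / Δ ^ 2)).queries =
        ∑ _i : Fin (repetitions (Δ / ε) δ), 1 := rfl
    rw [hq, Finset.sum_const, smul_eq_mul, mul_one]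
    exact Finset.card_image_le
  · exact Finset.mem_image.2 ⟨i, Finset.mem_univ i, by rw [hi, Equiv.symm_apply_apply]⟩
  · have hprob := bellExperiment_prob (ε.toNNReal / Δ ^ 2) H P
    refine le_of_le_of_eq ?_ hprob.symm
    rw [NNReal.coe_div, NNReal.coe_pow, Real.coe_toNNReal _ hε.le]
    have ht : (0 : ℝ) ≤ ε / Δ ^ 2 := by positivity
    have hx : ε / (Δ : ℝ) < 1 / 2 := by
      rw [lt_div_iff₀ hε] at hR
      rw [div_lt_iff₀ hΔ']
      linarith
    have hx0 : 0 < ε / (Δ : ℝ) := by positivity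
    have htH : ε / Δ ^ 2 * opNorm H ≤ ε / Δ / 2 := by
      calc ε / Δ ^ 2 * opNorm H ≤ ε / Δ ^ 2 * (Δ / 2) :=
            mul_le_mul_of_nonneg_left (by linarith) ht
        _ = ε / Δ / 2 := by field_simp
    have hnn : 0 ≤ ε / Δ ^ 2 * opNorm H := mul_nonneg ht (norm_nonneg _)
    have hmain := norm_pauliCoeff_evolution_ge hH P him ht (by linarith)
    have hsig : (ε / Δ) ^ 2 ≤ ε / Δ ^ 2 * ‖pauliCoeff P H‖ := by
      calc (ε / Δ) ^ 2 = ε / Δ ^ 2 * ε := by ring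
        _ ≤ _ := mul_le_mul_of_nonneg_left hP.le ht
    -- The factor 3/4 would be available; 1/8 gives exactly the probability threshold shared with
    -- the logarithm learner.
    have hge : (ε / Δ) ^ 2 / 8 ≤ ‖pauliCoeff P (evolution H (ε / Δ ^ 2))‖ := by
      nlinarith
    calc 1 / (64 * ((Δ : ℝ) / ε) ^ 4) = ((ε / Δ) ^ 2 / 8) ^ 2 := by
          field_simp
          norm_num
      _ ≤ _ := pow_le_pow_left₀ (by positivity) hge 2

/-! ### The coefficients of the truncated logarithm -/

theorem logCoeff_eq_zero {K j : ℕ} (h : K < j) : logCoeff K j = 0 := by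
  rw [logCoeff, if_neg (by omega), Nat.choose_eq_zero_of_lt h, Nat.cast_zero, mul_zero]

/-- The increment is the coefficient of A^j in the new series term, by the binomial theorem. For j ≥
1 it matches through Pascal's rule and the identity C(K+1, j)/(K+1) = C(K, j-1)/j. -/
theorem logCoeff_succ {K j : ℕ} (h : j ≤ K + 1) :
    logCoeff (K + 1) j = logCoeff K j +
      (-1) ^ (K + 2) / ((K + 1 : ℕ) : ℝ) * ((-1) ^ (K + 1 - j) * ((K + 1).choose j : ℝ)) := by
  have hK : ((K + 1 : ℕ) : ℝ) ≠ 0 := Nat.cast_ne_zero.2 (Nat.succ_ne_zero K)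
  rcases j with _ | j
  · rw [logCoeff, logCoeff, if_pos rfl, if_pos rfl, Finset.sum_Icc_succ_top (by omega),
      Nat.sub_zero, Nat.choose_zero_right, Nat.cast_one, mul_one, div_mul_eq_mul_div, ← pow_add,
      Odd.neg_one_pow ⟨K + 1, by ring⟩]
    ring
  · obtain ⟨d, rfl⟩ := Nat.exists_eq_add_of_le (Nat.le_of_succ_le_succ h)
    have hj : ((j + 1 : ℕ) : ℝ) ≠ 0 := Nat.cast_ne_zero.2 (Nat.succ_ne_zero j)
    have h1 : ((j + d + 1 : ℕ) : ℝ) * ((j + d).choose j : ℝ) =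
        ((j + d + 1).choose (j + 1) : ℝ) * ((j + 1 : ℕ) : ℝ) := by
      exact_mod_cast Nat.add_one_mul_choose_eq (j + d) j
    have h2 : ((j + d + 1).choose (j + 1) : ℝ) =
        (j + d).choose j + (j + d).choose (j + 1) := by
      exact_mod_cast Nat.choose_succ_succ (j + d) j
    have h3 : ((-1 : ℝ)) ^ (j + d + 2) * (-1) ^ (j + d + 1 - (j + 1)) = (-1) ^ j := by
      rw [show j + d + 1 - (j + 1) = d by omega, ← pow_add,
        show j + d + 2 + d = j + 2 * (d + 1) by ring, pow_add, pow_mul]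
      simp
    rw [logCoeff, logCoeff, if_neg (Nat.succ_ne_zero j), if_neg (Nat.succ_ne_zero j), ← mul_assoc,
      div_mul_eq_mul_div ((-1 : ℝ) ^ (j + d + 2)), h3]
    have h4 : ((j + d + 1).choose (j + 1) : ℝ) / ((j + d + 1 : ℕ) : ℝ) =
        (j + d).choose j / ((j + 1 : ℕ) : ℝ) := by
      rw [div_eq_div_iff hK hj]
      linarith
    rw [div_mul_eq_mul_div ((-1 : ℝ) ^ j), mul_div_assoc ((-1 : ℝ) ^ j), h4, h2, pow_add, pow_add]
    ring

theorem logPartial_eq_sum {n : ℕ} (K : ℕ) (A : Matrix (Bits n) (Bits n) ℂ) :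
    logPartial K A = ∑ j ∈ Finset.range (K + 1), (logCoeff K j : ℂ) • A ^ j := by
  induction K with
  | zero => simp [logPartial, logCoeff]
  | succ K ih =>
    have h1 : logPartial (K + 1) A = logPartial K A +
        ((-1 : ℂ) ^ (K + 2) / ((K + 1 : ℕ) : ℂ)) • (A - 1) ^ (K + 1) := by
      rw [logPartial, logPartial, Finset.sum_Icc_succ_top (by omega)]
    have h2 : (A - 1) ^ (K + 1) = ∑ j ∈ Finset.range (K + 1 + 1),
        ((-1 : ℂ) ^ (K + 1 - j) * ((K + 1).choose j : ℂ)) • A ^ j := by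
      rw [show A - 1 = A + (-1 : ℂ) • 1 by rw [neg_one_smul, sub_eq_add_neg],
        ((Commute.one_right A).smul_right (-1 : ℂ)).add_pow]
      refine Finset.sum_congr rfl fun j _ => ?_
      rw [smul_pow, one_pow, mul_smul_comm, mul_one, ← nsmul_eq_mul', ← Nat.cast_smul_eq_nsmul ℂ,
        smul_smul, mul_comm]
    have h3 : logPartial K A = ∑ j ∈ Finset.range (K + 1 + 1), (logCoeff K j : ℂ) • A ^ j := by
      rw [Finset.sum_range_succ, ← ih, logCoeff_eq_zero (Nat.lt_succ_self K)]
      simp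
    rw [h1, h2, h3, Finset.smul_sum, ← Finset.sum_add_distrib]
    refine Finset.sum_congr rfl fun j hj => ?_
    rw [logCoeff_succ (Finset.mem_range_succ_iff.1 hj), smul_smul, ← add_smul]
    push_cast
    rfl

theorem one_le_logNorm {K : ℕ} (hK : 1 ≤ K) : 1 ≤ logNorm K := by
  have h1 : (1 : ℝ) ≤ ∑ k ∈ Finset.Icc 1 K, (1 : ℝ) / k := by
    refine le_of_eq_of_le ?_ (Finset.single_le_sum (f := fun k : ℕ => (1 : ℝ) / k)
      (fun _ _ => by positivity) (Finset.mem_Icc.2 ⟨le_rfl, hK⟩))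
    simp
  refine le_trans ?_ (Finset.single_le_sum (f := fun j => |logCoeff K j|)
    (fun _ _ => abs_nonneg _) (Finset.mem_range.2 (Nat.succ_pos K)))
  rw [logCoeff, if_pos rfl, abs_neg]
  exact h1.trans (le_abs_self _)

/-- For j ≥ 1 the coefficient is at most C(K, j), and |c_0| ≤ K; the total is at most 2^K + K. This
is exponential in `K`, but `K` will be logarithmic in Δ/ε. -/
theorem logNorm_le (K : ℕ) : logNorm K ≤ 2 ^ (K + 1) := by
  have h : ∀ j ∈ Finset.range (K + 1),
      |logCoeff K j| ≤ (K.choose j : ℝ) + if j = 0 then (K : ℝ) else 0 := by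
    intro j _
    rw [logCoeff]
    split_ifs with hj
    · rw [abs_neg, abs_of_nonneg (Finset.sum_nonneg fun _ _ => by positivity)]
      have : ∑ k ∈ Finset.Icc 1 K, (1 : ℝ) / k ≤ ∑ _k ∈ Finset.Icc 1 K, (1 : ℝ) := by
        refine Finset.sum_le_sum fun k hk => ?_
        have hk1 : (1 : ℝ) ≤ k := by exact_mod_cast (Finset.mem_Icc.1 hk).1
        exact (div_le_one (by linarith)).2 hk1
      rw [Finset.sum_const, Nat.card_Icc, Nat.add_sub_cancel, nsmul_eq_mul, mul_one] at this
      have h0 : (0 : ℝ) ≤ K.choose j := Nat.cast_nonneg _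
      linarith
    · have hj1 : (1 : ℝ) ≤ j := by exact_mod_cast Nat.one_le_iff_ne_zero.2 hj
      rw [abs_mul, abs_div, abs_pow, abs_neg, abs_one, one_pow, Nat.abs_cast, Nat.abs_cast,
        add_zero]
      refine mul_le_of_le_one_left (Nat.cast_nonneg _) ?_
      exact (div_le_one (by linarith)).2 hj1
  refine (Finset.sum_le_sum h).trans ?_
  rw [Finset.sum_add_distrib, Finset.sum_ite_eq', if_pos (Finset.mem_range.2 (Nat.succ_pos K)),
    ← Nat.cast_sum, Nat.sum_range_choose, pow_succ]
  have : (K : ℝ) ≤ 2 ^ K := by exact_mod_cast Nat.lt_two_pow_self.le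
  push_cast
  linarith

/-! ### State preparation pairs -/

theorem digits_bijective (q : ℕ) :
    Function.Bijective (fun j : Fin (2 ^ q) => digits q j) := by
  rw [Fintype.bijective_iff_injective_and_card]
  refine ⟨fun j k h => Fin.ext (Nat.eq_of_testBit_eq fun i => ?_), by simp⟩
  rcases lt_or_ge i q with hi | hi
  · exact congrFun h ⟨i, hi⟩
  · have h2 : 2 ^ q ≤ 2 ^ i := Nat.pow_le_pow_right (by norm_num) hi
    rw [Nat.testBit_eq_false_of_lt (j.2.trans_le h2), Nat.testBit_eq_false_of_lt (k.2.trans_le h2)]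

/-- The numbers below `2 ^ q`, as basis states of `q` qubits. -/
noncomputable def digitsEquiv (q : ℕ) : Fin (2 ^ q) ≃ Bits q :=
  Equiv.ofBijective _ (digits_bijective q)

/-- The number whose binary digits are `f`. -/
noncomputable def index {q : ℕ} (f : Bits q) : ℕ := (digitsEquiv q).symm f

theorem index_lt {q : ℕ} (f : Bits q) : index f < 2 ^ q := ((digitsEquiv q).symm f).2

theorem digits_index {q : ℕ} (f : Bits q) : digits q (index f) = f :=
  (digitsEquiv q).apply_symm_apply f

theorem index_digits {q j : ℕ} (hj : j < 2 ^ q) : index (digits q j) = j :=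
  congrArg Fin.val ((digitsEquiv q).symm_apply_apply ⟨j, hj⟩)

theorem eq_digits_iff {q j : ℕ} (hj : j < 2 ^ q) (f : Bits q) : f = digits q j ↔ index f = j := by
  constructor
  · rintro rfl
    exact index_digits hj
  · rintro rfl
    exact (digits_index f).symm

theorem sum_bits_eq_sum_range {M : Type} [AddCommMonoid M] (q : ℕ) (g : ℕ → M) :
    ∑ f : Bits q, g (index f) = ∑ j ∈ Finset.range (2 ^ q), g j := by
  rw [← (digitsEquiv q).sum_comp, ← Fin.sum_univ_eq_sum_range]
  refine Finset.sum_congr rfl fun j _ => ?_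
  exact congrArg g (index_digits j.2)

/-- A unit vector extends to an orthonormal basis, whose vectors are the columns of a unitary. -/
theorem exists_unitary_col {ι : Type} [Fintype ι] [DecidableEq ι] (v : ι → ℂ)
    (hv : ∑ f, ‖v f‖ ^ 2 = 1) (a : ι) :
    ∃ U : unitaryGroup ι ℂ, ∀ f, U.1 f a = v f := by
  have hnorm : ‖WithLp.toLp 2 v‖ = 1 := by
    rw [EuclideanSpace.norm_eq, Real.sqrt_eq_one]
    exact hv
  have horth : Orthonormal ℂ (({a} : Set ι).domRestrict fun _ => WithLp.toLp 2 v) := by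
    refine ⟨fun _ => hnorm, fun i j hij => absurd (Subsingleton.elim i j) hij⟩
  obtain ⟨b, hb⟩ := horth.exists_orthonormalBasis_extension_of_card_eq (by simp)
  refine ⟨⟨_, (EuclideanSpace.basisFun ι ℂ).toMatrix_orthonormalBasis_mem_unitary b⟩, fun f => ?_⟩
  change (EuclideanSpace.basisFun ι ℂ).toBasis.toMatrix b f a = v f
  rw [Module.Basis.toMatrix_apply, hb a rfl]
  simp

theorem succ_le_two_pow_flagQubits (K : ℕ) : K + 1 ≤ 2 ^ flagQubits K :=
  Nat.le_pow_clog (by norm_num) _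

theorem sum_range_two_pow_flagQubits {M : Type} [AddCommMonoid M] (K : ℕ) (g : ℕ → M)
    (hg : ∀ j, K < j → g j = 0) :
    ∑ j ∈ Finset.range (2 ^ flagQubits K), g j = ∑ j ∈ Finset.range (K + 1), g j := by
  refine (Finset.sum_subset (Finset.range_mono (succ_le_two_pow_flagQubits K)) ?_).symm
  exact fun j _ hj => hg j (by simpa using hj)

theorem exists_isLogPrepPair {K : ℕ} (hK : 1 ≤ K) : ∃ PL PR, IsLogPrepPair K PL PR := by
  have hΛ : 0 < logNorm K := lt_of_lt_of_le one_pos (one_le_logNorm hK)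
  -- Both unitaries get the amplitudes √(|c_j|/Λ) in their first column, so that the products have
  -- modulus |c_j|/Λ.
  set a : ℕ → ℝ := fun j => √(|logCoeff K j| / logNorm K) with ha
  have ha2 : ∀ j, a j ^ 2 = |logCoeff K j| / logNorm K := fun j => Real.sq_sqrt (by positivity)
  have hsum : ∑ f : Bits (flagQubits K), a (index f) ^ 2 = 1 := by
    rw [sum_bits_eq_sum_range _ fun j => a j ^ 2,
      sum_range_two_pow_flagQubits K (fun j => a j ^ 2)]
    · simp only [ha2]
      rw [← Finset.sum_div]
      exact div_self hΛ.ne'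
    · intro j hj
      rw [ha2, logCoeff_eq_zero hj, abs_zero, zero_div]
  obtain ⟨PR, hPR⟩ := exists_unitary_col (fun f : Bits (flagQubits K) => (a (index f) : ℂ))
    (by simpa using hsum) (digits _ 0)
  -- All phases are put into `PL`, whose entries are conjugated in the product: -i becomes i for c_j
  -- ≥ 0, and i becomes -i for c_j < 0.
  obtain ⟨PL, hPL⟩ := exists_unitary_col (fun f : Bits (flagQubits K) =>
    (if 0 ≤ logCoeff K (index f) then -Complex.I else Complex.I) * (a (index f) : ℂ)) (by
      rw [← hsum]
      refine Finset.sum_congr rfl fun f _ => ?_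
      split_ifs <;> simp) (digits _ 0)
  have hmul : ∀ j, j < 2 ^ flagQubits K →
      star (PL.1 (digits _ j) (digits _ 0)) * PR.1 (digits _ j) (digits _ 0) =
        Complex.I * ((logCoeff K j / logNorm K : ℝ) : ℂ) := by
    intro j hj
    have h2 : (a j : ℂ) * a j = ((|logCoeff K j| / logNorm K : ℝ) : ℂ) := by
      rw [← ha2, sq, Complex.ofReal_mul]
    rw [hPL, hPR, index_digits hj, star_mul', mul_assoc, Complex.star_def,
      Complex.conj_ofReal, h2]
    split_ifs with h
    · rw [abs_of_nonneg h]
      simp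
    · rw [abs_of_neg (not_le.1 h), neg_div]
      simp
  refine ⟨PL, PR, succ_le_two_pow_flagQubits K, ?_, ?_, ?_⟩
  · rw [Fin.sum_univ_eq_sum_range (fun j => ‖Complex.I * (logCoeff K j : ℂ)‖) (K + 1)]
    refine (Finset.sum_congr rfl fun j _ => ?_).le
    simp
  · refine (Finset.sum_eq_zero fun j _ => ?_).le
    rw [hmul j (j.2.trans_le (succ_le_two_pow_flagQubits K)), norm_eq_zero, sub_eq_zero]
    push_cast
    have : (logNorm K : ℂ) ≠ 0 := Complex.ofReal_ne_zero.2 hΛ.ne'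
    field_simp
  · intro j hj hj2
    rw [hmul j hj2, logCoeff_eq_zero hj]
    simp

/-- Accuracy 0 forces every summand of the error to vanish. Since c_j = 0 for j > K, one formula
covers the padding states too. -/
theorem IsLogPrepPair.star_mul_eq {K : ℕ} (hK : 1 ≤ K)
    {PL PR : unitaryGroup (Bits (flagQubits K)) ℂ} (h : IsLogPrepPair K PL PR) {j : ℕ}
    (hj : j < 2 ^ flagQubits K) :
    star (PL.1 (digits _ j) (digits _ 0)) * PR.1 (digits _ j) (digits _ 0) =
      (logNorm K : ℂ)⁻¹ * (Complex.I * logCoeff K j) := by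
  have hΛ : (logNorm K : ℂ) ≠ 0 :=
    Complex.ofReal_ne_zero.2 (lt_of_lt_of_le one_pos (one_le_logNorm hK)).ne'
  obtain ⟨-, -, h3, h4⟩ := h
  rcases lt_or_ge j (K + 1) with hjK | hjK
  · have h5 := (Finset.sum_eq_zero_iff_of_nonneg fun _ _ => norm_nonneg _).1
      (le_antisymm h3 (Finset.sum_nonneg fun _ _ => norm_nonneg _)) ⟨j, hjK⟩ (Finset.mem_univ _)
    rw [norm_eq_zero, sub_eq_zero] at h5
    change _ = Complex.I * (logCoeff K j : ℂ) at h5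
    rw [← h5, inv_mul_cancel_left₀ hΛ]
  · rw [h4 j hjK hj, logCoeff_eq_zero hjK]
    simp

/-! ### The circuit for the truncated logarithm -/

/-- The state `∑ f, |f⟩ ⊗ (A f ⊗ 1) |Ω⟩` of flag, system and reference. -/
noncomputable def branchVec {n q : ℕ} (A : Bits q → Matrix (Bits n) (Bits n) ℂ) :
    Joint n (Fin q ⊕ Fin n) → ℂ :=
  fun p => choiVec (A (flagOf p)) (dataOf p)

theorem bellInit_eq_branchVec (n q : ℕ) :
    bellInit n q = branchVec fun f => if f = digits q 0 then 1 else 0 := by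
  ext p
  rw [bellInit, branchVec]
  split_ifs with h
  · rw [choiVec_one]
  · rw [choiVec_zero, Pi.zero_apply]

theorem onFlag_mulVec_branchVec {n q : ℕ} (V : unitaryGroup (Bits q) ℂ)
    (A : Bits q → Matrix (Bits n) (Bits n) ℂ) :
    (onFlag (n := n) V).1.mulVec (branchVec A) = branchVec fun f => ∑ g, V.1 f g • A g := by
  ext p
  have h1 : ∀ g d, (onFlag (n := n) V).1 p (jointEquiv n q (g, d)) *
      branchVec A (jointEquiv n q (g, d)) =
      V.1 (flagOf p) g * ((1 : Matrix (Bits n × Bits n) (Bits n × Bits n) ℂ) (dataOf p) d *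
        choiVec (A g) d) := by
    intro g d
    rw [← mul_assoc]
    change (reindex (jointEquiv n q) (jointEquiv n q) (V.1 ⊗ₖ 1)) p (jointEquiv n q (g, d)) * _ = _
    rw [reindex_apply, submatrix_apply, Equiv.symm_apply_apply]
    rfl
  rw [mulVec, dotProduct, ← (jointEquiv n q).sum_comp, Fintype.sum_prod_type]
  simp only [h1]
  rw [branchVec, ← Prod.mk.eta (p := dataOf p), choiVec_apply, Matrix.sum_apply, Finset.sum_mul]
  refine Finset.sum_congr rfl fun g _ => ?_
  rw [← Finset.mul_sum, Matrix.smul_apply, smul_eq_mul, mul_assoc, ← choiVec_apply]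
  simp [one_apply]

theorem selectQuery_mulVec_branchVec {n q : ℕ} (j : ℕ) (t : ℝ≥0) (H : Matrix (Bits n) (Bits n) ℂ)
    (A : Bits q → Matrix (Bits n) (Bits n) ℂ) :
    ((selectQuery n q j t).gate H).mulVec (branchVec A) =
      branchVec fun f => if f = digits q j then evolution H (j * t) * A f else A f := by
  ext ⟨x, s⟩
  have hcond : (∀ i b, (selectQuery n q j t).control i = some b → x i = b) ↔
      flagOf (n := n) (q := q) (x, s) = digits q j := by
    constructor
    · exact fun h => funext fun i => h (Sum.inl i) _ rfl
    · rintro h (i | i) b hb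
      · rw [← Option.some.inj hb]
        exact congrFun h i
      · exact absurd hb (by simp [selectQuery])
  rw [Query.gate_mulVec_apply]
  simp only [hcond]
  by_cases h : flagOf (n := n) (q := q) (x, s) = digits q j
  · have h2 : ((selectQuery n q j t).time : ℝ) = j * t := by simp [selectQuery]
    rw [if_pos h, h2]
    conv_rhs => rw [branchVec, if_pos h]
    exact (choiVec_mul_apply (evolution H (j * t)) (A (flagOf (n := n) (q := q) (x, s))) s
      fun i => x (Sum.inr i)).symm
  · rw [if_neg h]
    conv_rhs => rw [branchVec, if_neg h]
    rfl

/-- The operator `U ^ j`, if the flag is the state `j` and at most `m`. -/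
noncomputable def selected {n q : ℕ} (H : Matrix (Bits n) (Bits n) ℂ) (t : ℝ≥0) (m : ℕ)
    (f : Bits q) : Matrix (Bits n) (Bits n) ℂ :=
  if index f ≤ m then evolution H (index f * t) else 1

theorem selectQuery_mulVec_selected {n q m : ℕ} (hm : m + 1 < 2 ^ q)
    (H : Matrix (Bits n) (Bits n) ℂ) (t : ℝ≥0) (c : Bits q → ℂ) :
    ((selectQuery n q (m + 1) t).gate H).mulVec (branchVec fun f => c f • selected H t m f) =
      branchVec fun f => c f • selected H t (m + 1) f := by
  rw [selectQuery_mulVec_branchVec]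
  congr 1
  ext1 f
  by_cases h : index f = m + 1
  · rw [if_pos ((eq_digits_iff hm f).2 h), selected, selected, h, if_neg (by omega), if_pos le_rfl,
      mul_smul_comm, mul_one]
  · rw [if_neg (mt (eq_digits_iff hm f).1 h), selected, selected]
    congr 1
    by_cases h2 : index f ≤ m
    · rw [if_pos h2, if_pos (by omega)]
    · rw [if_neg h2, if_neg (by omega)]

theorem selected_zero {n q : ℕ} (H : Matrix (Bits n) (Bits n) ℂ) (t : ℝ≥0) (f : Bits q) :
    selected H t 0 f = 1 := by
  rw [selected]
  split_ifs with h
  · rw [Nat.le_zero.1 h, Nat.cast_zero, zero_mul, evolution_zero]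
  · rfl

/-- Each query changes only its own branch, giving induction on the number of queries. The bound `m
≤ k` excludes the last query, the only one followed by `V`. -/
theorem select_foldl_mulVec {n q k : ℕ} (hk : k + 1 < 2 ^ q) (H : Matrix (Bits n) (Bits n) ℂ)
    (t : ℝ≥0) (W V : unitaryGroup (Joint n (Fin q ⊕ Fin n)) ℂ) (v : Joint n (Fin q ⊕ Fin n) → ℂ)
    (c : Bits q → ℂ) (hW : W.1.mulVec v = branchVec fun f => c f • (1 : Matrix _ _ ℂ)) {m : ℕ}
    (hm : m ≤ k) :
    ((((List.range m).map fun j => (selectQuery n q (j + 1) t,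
      if j + 1 = k + 1 then V else 1)).foldl (fun M s => s.2.1 * s.1.gate H * M) W.1).mulVec v) =
      branchVec fun f => c f • selected H t m f := by
  induction m with
  | zero =>
    simp only [List.range_zero, List.map_nil, List.foldl_nil, selected_zero]
    exact hW
  | succ m ih =>
    rw [List.range_succ, List.map_append, List.foldl_append, List.map_singleton, List.foldl_cons,
      List.foldl_nil, if_neg (by omega), ← mulVec_mulVec, ih (by omega), OneMemClass.coe_one,
      one_mul, selectQuery_mulVec_selected (by omega)]

theorem logExperiment_final {n K : ℕ} (hK : 1 ≤ K) (Δ : ℝ≥0)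
    (PL PR : unitaryGroup (Bits (flagQubits K)) ℂ) (H : Matrix (Bits n) (Bits n) ℂ) :
    (logExperiment n K Δ PL PR).final H = branchVec fun f => ∑ g, star (PL.1 g f) •
      PR.1 g (digits _ 0) • selected H Δ⁻¹ K g := by
  -- The last query must exist, because the circuit attaches `PL†` to it.
  obtain ⟨k, rfl⟩ := Nat.exists_eq_add_of_le' hK
  have hk : k + 1 < 2 ^ flagQubits (k + 1) := succ_le_two_pow_flagQubits (k + 1)
  have hinit : (onFlag (n := n) PR).1.mulVec (bellInit n (flagQubits (k + 1))) =
      branchVec fun f => PR.1 f (digits _ 0) • (1 : Matrix _ _ ℂ) := by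
    rw [bellInit_eq_branchVec, onFlag_mulVec_branchVec]
    congr 1
    ext1 f
    simp
  have h := select_foldl_mulVec hk H Δ⁻¹ (onFlag (n := n) PR) (onFlag (star PL)) _ _ hinit le_rfl
  rw [Experiment.final, ControlCircuit.eval]
  simp only [logExperiment, logCircuit]
  rw [List.range_succ, List.map_append, List.foldl_append, List.map_singleton, List.foldl_cons,
    List.foldl_nil, if_pos rfl, ← mulVec_mulVec, h, ← mulVec_mulVec,
    selectQuery_mulVec_selected hk, onFlag_mulVec_branchVec]
  rfl

/-- Linear combination of unitaries: projecting the flag onto 0 after `PL†` sums the branches U^j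
with weights i c_j/Λ, and these sum to i L_K(U)/Λ. -/
theorem flaggedState_eq {n K : ℕ} (hK : 1 ≤ K) (Δ : ℝ≥0)
    {PL PR : unitaryGroup (Bits (flagQubits K)) ℂ} (h : IsLogPrepPair K PL PR)
    (H : Matrix (Bits n) (Bits n) ℂ) :
    flaggedState K Δ PL PR H = (logNorm K : ℂ)⁻¹ •
      choiVec (Complex.I • logPartial K (evolution H (1 / Δ))) := by
  have hA : ∑ g, star (PL.1 g (digits _ 0)) • PR.1 g (digits _ 0) • selected H Δ⁻¹ K g =
      (logNorm K : ℂ)⁻¹ • Complex.I • logPartial K (evolution H (1 / Δ)) := by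
    have hterm : ∀ g : Bits (flagQubits K), star (PL.1 g (digits _ 0)) • PR.1 g (digits _ 0) •
        selected H Δ⁻¹ K g = ((logNorm K : ℂ)⁻¹ * (Complex.I * logCoeff K (index g))) •
          evolution H (1 / Δ) ^ index g := by
      intro g
      have h1 := h.star_mul_eq hK (index_lt g)
      rw [digits_index] at h1
      rw [smul_smul, h1, selected]
      split_ifs with hg
      · rw [← evolution_natCast_mul, NNReal.coe_inv, one_div]
      · rw [logCoeff_eq_zero (not_le.1 hg)]
        simp
    simp only [hterm]
    rw [sum_bits_eq_sum_range _ fun j => ((logNorm K : ℂ)⁻¹ * (Complex.I * logCoeff K j)) •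
      evolution H (1 / Δ) ^ j, sum_range_two_pow_flagQubits, logPartial_eq_sum, Finset.smul_sum,
      Finset.smul_sum]
    · simp only [smul_smul]
    · intro j hj
      rw [logCoeff_eq_zero hj]
      simp
  ext p
  rw [flaggedState, logExperiment_final hK, ← choiVec_smul, ← hA]
  rfl

/-! ### The pseudo-Choi state and its outcome probabilities -/

theorem vecNorm_smul {ι : Type} [Fintype ι] (c : ℂ) (v : ι → ℂ) :
    vecNorm (c • v) = ‖c‖ * vecNorm v := by
  simp only [vecNorm, Pi.smul_apply, smul_eq_mul, norm_mul, mul_pow]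
  rw [← Finset.mul_sum, Real.sqrt_mul (by positivity), Real.sqrt_sq (norm_nonneg c)]

theorem eq_zero_of_vecNorm_eq_zero {ι : Type} [Fintype ι] {v : ι → ℂ} (h : vecNorm v = 0) :
    v = 0 := by
  rw [vecNorm, Real.sqrt_eq_zero (by positivity),
    Finset.sum_eq_zero_iff_of_nonneg fun _ _ => by positivity] at h
  ext i
  exact norm_eq_zero.1 (pow_eq_zero_iff two_ne_zero |>.1 (h i (Finset.mem_univ i)))

theorem flaggedState_eq_pseudoChoi {n K : ℕ} (hK : 1 ≤ K) {Δ : ℝ≥0} (hΔ : 0 < Δ)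
    {PL PR : unitaryGroup (Bits (flagQubits K)) ℂ} (h : IsLogPrepPair K PL PR)
    (H : Matrix (Bits n) (Bits n) ℂ) :
    flaggedState K Δ PL PR H =
      ((vecNorm (choiVec (Complex.I • logPartial K (evolution H (1 / Δ)))) / logNorm K : ℝ) : ℂ) •
        pseudoChoi ((Complex.I * ((Δ : ℝ) : ℂ)) • logPartial K (evolution H (1 / Δ))) := by
  have hΔ' : ((Δ : ℝ) : ℂ) ≠ 0 := Complex.ofReal_ne_zero.2 (NNReal.coe_ne_zero.2 hΔ.ne')
  rw [flaggedState_eq hK Δ h, pseudoChoi, mul_comm, mul_smul, choiVec_smul ((Δ : ℝ) : ℂ),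
    vecNorm_smul, Complex.norm_real, Real.norm_of_nonneg Δ.coe_nonneg]
  set v := choiVec (Complex.I • logPartial K (evolution H (1 / Δ))) with hv
  -- If the vector vanishes, both sides are 0; otherwise the normalization cancels, and so does the
  -- positive factor Δ.
  by_cases h0 : vecNorm v = 0
  · rw [eq_zero_of_vecNorm_eq_zero h0]
    simp
  · have h1 : (vecNorm v : ℂ) ≠ 0 := Complex.ofReal_ne_zero.2 h0
    rw [smul_smul, smul_smul]
    congr 1
    push_cast
    field_simp

theorem logExperiment_prob {n K : ℕ} (hK : 1 ≤ K) (Δ : ℝ≥0)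
    {PL PR : unitaryGroup (Bits (flagQubits K)) ℂ} (h : IsLogPrepPair K PL PR)
    (H : Matrix (Bits n) (Bits n) ℂ) (P : PauliString n) :
    (logExperiment n K Δ PL PR).prob H (digits _ 0, P) =
      (‖pauliCoeff P (Complex.I • logPartial K (evolution H (1 / Δ)))‖ / logNorm K) ^ 2 := by
  have h1 : star (bellVec (digits (flagQubits K) 0, P)) ⬝ᵥ (logExperiment n K Δ PL PR).final H =
      star (choiVec P.matrix) ⬝ᵥ flaggedState K Δ PL PR H := by
    rw [dotProduct, ← (jointEquiv n _).sum_comp, Fintype.sum_prod_type,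
      Finset.sum_eq_single (digits _ 0)]
    · refine Finset.sum_congr rfl fun d _ => ?_
      rw [Pi.star_apply, bellVec]
      rw [if_pos (by rfl)]
      rfl
    · intro f _ hf
      refine Finset.sum_eq_zero fun d _ => ?_
      rw [Pi.star_apply, bellVec]
      rw [if_neg (by exact hf), star_zero, zero_mul]
    · simp
  have h2 : (logExperiment n K Δ PL PR).prob H (digits _ 0, P) =
      ‖star (bellVec (digits (flagQubits K) 0, P)) ⬝ᵥ (logExperiment n K Δ PL PR).final H‖ ^ 2 :=
    re_dotProduct_vecMulVec _ _
  have hΛ : 0 ≤ logNorm K := zero_le_one.trans (one_le_logNorm hK)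
  rw [h2, h1, flaggedState_eq hK Δ h, dotProduct_smul, ← pauliCoeff_apply, norm_smul, norm_inv,
    Complex.norm_real, Real.norm_of_nonneg hΛ, inv_mul_eq_div]

/-! ### Truncation order, costs and correctness of the logarithm learner -/

/-- The order at which the logarithm is truncated for the accuracy `1 / R`. -/
noncomputable def truncation (R : ℝ) : ℕ := Nat.log 2 ⌊R⌋₊ + 1

/-- This lower bound on 2^K controls the truncation error; the upper bound `two_pow_truncation_le`
controls Λ. -/
theorem lt_two_pow_truncation (R : ℝ) : R < 2 ^ truncation R := by
  have h : ⌊R⌋₊ + 1 ≤ 2 ^ truncation R := Nat.lt_pow_succ_log_self (by norm_num) _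
  refine (Nat.lt_floor_add_one R).trans_le ?_
  exact_mod_cast h

theorem two_pow_truncation_le {R : ℝ} (hR : 1 ≤ R) : 2 ^ truncation R ≤ 2 * R := by
  have h0 : ⌊R⌋₊ ≠ 0 := (Nat.floor_pos.2 hR).ne'
  have h : 2 ^ Nat.log 2 ⌊R⌋₊ ≤ ⌊R⌋₊ := Nat.pow_log_le_self 2 h0
  have h2 : (2 : ℝ) ^ Nat.log 2 ⌊R⌋₊ ≤ ⌊R⌋₊ := by exact_mod_cast h
  have h3 := Nat.floor_le (zero_le_one.trans hR)
  rw [truncation, pow_succ]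
  linarith

theorem truncation_le {R : ℝ} (hR : 1 ≤ R) : (truncation R : ℝ) ≤ 3 * Real.log (2 + R) := by
  have h := Real.log_le_log (by positivity) (two_pow_truncation_le hR)
  rw [Real.log_pow, Real.log_mul (by norm_num) (by linarith)] at h
  have h2 : Real.log R ≤ Real.log (2 + R) := Real.log_le_log (by linarith) (by linarith)
  have h3 : Real.log 2 ≤ Real.log (2 + R) := Real.log_le_log (by norm_num) (by linarith)
  have h4 := Real.log_two_gt_d9
  have h5 := one_le_log_two_add hR
  -- From (K - 1) log 2 ≤ log R and log 2 > 0.69 it follows that K ≤ 1 + log(2 + R)/0.69, which is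
  -- below 3 log(2 + R).
  have h6 : ((truncation R : ℝ) - 1) * 0.69 ≤ ((truncation R : ℝ) - 1) * Real.log 2 := by
    refine mul_le_mul_of_nonneg_left (by linarith) ?_
    rw [truncation]
    push_cast
    linarith [Nat.cast_nonneg (α := ℝ) (Nat.log 2 ⌊R⌋₊)]
  linarith

theorem one_le_truncation (R : ℝ) : 1 ≤ truncation R := Nat.succ_pos _

theorem logCircuit_queries (n K : ℕ) (Δ : ℝ≥0) (PL PR : unitaryGroup (Bits (flagQubits K)) ℂ) :
    (logCircuit n K Δ PL PR).queries = K := by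
  simp [logCircuit, ControlCircuit.queries]

/-- Each of the `K` queries takes time at most K/Δ. -/
theorem logCircuit_time_le (n K : ℕ) (Δ : ℝ≥0) (PL PR : unitaryGroup (Bits (flagQubits K)) ℂ) :
    ((logCircuit n K Δ PL PR).time : ℝ) ≤ (K : ℝ) ^ 2 / Δ := by
  have h : (logCircuit n K Δ PL PR).time ≤ K • (K * Δ⁻¹) := by
    refine (List.sum_le_card_nsmul _ (K * Δ⁻¹) fun t ht => ?_).trans_eq ?_
    · simp only [logCircuit, List.map_map, List.mem_map, List.mem_range] at ht
      obtain ⟨j, hj, rfl⟩ := ht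
      have : ((j + 1 : ℕ) : ℝ≥0) ≤ K := by exact_mod_cast hj
      exact mul_le_mul_of_nonneg_right this zero_le
    · simp [logCircuit]
  have h2 := NNReal.coe_le_coe.2 h
  rw [NNReal.coe_nsmul, NNReal.coe_mul, NNReal.coe_inv, NNReal.coe_natCast, nsmul_eq_mul] at h2
  exact h2.trans_eq (by ring)

theorem logLearner_costBound (n : ℕ) {Δ : ℝ≥0} {ε δ : ℝ} (hΔ : 0 < Δ) (hε : 0 < ε) (hδ : 0 < δ)
    (hδ1 : δ < 1) (PL PR : unitaryGroup (Bits (flagQubits (truncation (Δ / ε)))) ℂ) :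
    (logLearner n (truncation (Δ / ε)) (repetitions (Δ / ε) δ) Δ PL PR).CostBound
      1161 3 Δ ε δ := by
  refine Learner.costBound _ hΔ hε hδ hδ1 rfl (fun hR i => ?_) (fun hR i => ?_)
  · refine le_of_eq_of_le (congrArg Nat.cast (logCircuit_queries n _ Δ PL PR)) ?_
    exact truncation_le (by linarith)
  · refine (logCircuit_time_le n _ Δ PL PR).trans ?_
    refine div_le_div_of_nonneg_right ?_ Δ.coe_nonneg
    refine (pow_le_pow_left₀ (Nat.cast_nonneg _) (truncation_le (by linarith)) 2).trans_eq ?_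
    ring

theorem mem_logLearner_output {n K N : ℕ} {Δ : ℝ≥0} {PL PR : unitaryGroup (Bits (flagQubits K)) ℂ}
    {ω : Fin N → Bits (flagQubits K) × PauliString n} {P : PauliString n} :
    P ∈ (logLearner n K N Δ PL PR).output ω ↔ ∃ i, ω i = (digits _ 0, P) := by
  simp [logLearner]

theorem logLearner_card_le {n K : ℕ} (hK : 1 ≤ K) (N : ℕ) (Δ : ℝ≥0)
    (PL PR : unitaryGroup (Bits (flagQubits K)) ℂ)
    (ω : Fin N → Bits (flagQubits K) × PauliString n) :
    ((logLearner n K N Δ PL PR).output ω).card ≤ (logLearner n K N Δ PL PR).queries := by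
  classical
  have hq : (logLearner n K N Δ PL PR).queries = ∑ _i : Fin N, K := by
    exact Finset.sum_congr rfl fun i _ => logCircuit_queries n K Δ PL PR
  have hsub : (logLearner n K N Δ PL PR).output ω ⊆ Finset.univ.image fun i => (ω i).2 := by
    intro P hP
    obtain ⟨i, hi⟩ := mem_logLearner_output.1 hP
    exact Finset.mem_image.2 ⟨i, Finset.mem_univ i, by rw [hi]⟩
  rw [hq, Finset.sum_const, smul_eq_mul]
  exact ((Finset.card_le_card hsub).trans Finset.card_image_le).trans (Nat.le_mul_of_pos_right _ hK)

/-- The error 2^-(K+1) is at most half of the signal ε/Δ, and Λ ≤ 4Δ/ε. Squaring the ratio gives the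
threshold 1/(64 R⁴), the origin of the constant 64. -/
theorem logLearner_learnsStructure (n : ℕ) {Δ : ℝ≥0} {ε δ : ℝ} (hΔ : 0 < Δ) (hε : 0 < ε)
    (hδ : 0 < δ) {PL PR : unitaryGroup (Bits (flagQubits (truncation (Δ / ε)))) ℂ}
    (h : IsLogPrepPair _ PL PR) :
    (logLearner n (truncation (Δ / ε)) (repetitions (Δ / ε) δ) Δ PL PR).LearnsStructure Δ ε δ := by
  have hΔ' : (0 : ℝ) < Δ := hΔ
  have hK := one_le_truncation ((Δ : ℝ) / ε)
  refine Learner.learnsStructure _ hΔ hε hδ (logLearner_card_le hK _ Δ PL PR) rfl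
    (fun P => (digits _ 0, P)) (fun P ω i hi => ?_) fun hR H hH hHΔ P _ hP i => ?_
  · exact mem_logLearner_output.2 ⟨i, hi⟩
  · refine le_of_le_of_eq ?_ (logExperiment_prob hK Δ h H P).symm
    have hlow := lt_two_pow_truncation ((Δ : ℝ) / ε)
    have hup := two_pow_truncation_le (R := (Δ : ℝ) / ε) (by linarith)
    have hΛ1 := one_le_logNorm hK
    have hΛ := logNorm_le (truncation ((Δ : ℝ) / ε))
    set K := truncation ((Δ : ℝ) / ε)
    have htH : 1 / Δ * opNorm H ≤ 1 / 2 := by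
      rw [one_div_mul_eq_div, div_le_iff₀ hΔ']
      linarith
    have hmain := norm_pauliCoeff_logPartial_ge hH P hK (t := 1 / Δ) (by positivity) htH
    have herr : (1 / 2 : ℝ) ^ (K + 1) ≤ ε / Δ / 2 := by
      rw [pow_succ, mul_one_div, _root_.one_div_pow]
      refine div_le_div_of_nonneg_right ?_ (by norm_num)
      rw [← one_div_div (Δ : ℝ) ε]
      exact one_div_le_one_div_of_le (by positivity) hlow.le
    have hsig : ε / Δ ≤ 1 / Δ * ‖pauliCoeff P H‖ := by
      rw [one_div_mul_eq_div]
      gcongr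
    have hcoeff : ε / Δ / 2 ≤
        ‖pauliCoeff P (Complex.I • logPartial K (evolution H (1 / Δ)))‖ := by linarith
    have hΛ4 : logNorm K ≤ 4 * (Δ / ε) := by
      rw [pow_succ] at hΛ
      linarith
    calc 1 / (64 * ((Δ : ℝ) / ε) ^ 4) = (ε / Δ / 2 / (4 * (Δ / ε))) ^ 2 := by
          field_simp
          norm_num
      _ ≤ _ := by gcongr

end HamLearn

theorem mainTheorem10 :
    ∃ (C : ℝ) (k : ℕ), 0 < C ∧
      ∀ (n : ℕ) (Δ : NNReal) (ε δ : ℝ), 0 < Δ → 0 < ε → 0 < δ → δ < 1 →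
        (∃ (a w : ℕ) (L : HamLearn.Learner n (Fin a) (Fin w)),
          L.Uncontrolled ∧ L.CostBound C k Δ ε δ ∧ L.LearnsStructure Δ ε δ) ∧
        (∃ K N : ℕ, 1 ≤ K ∧
          (∃ PL PR, HamLearn.IsLogPrepPair K PL PR) ∧
          ∀ PL PR, HamLearn.IsLogPrepPair K PL PR →
            (HamLearn.logLearner n K N Δ PL PR).CostBound C k Δ ε δ ∧
            (HamLearn.logLearner n K N Δ PL PR).LearnsStructure Δ ε δ ∧
            ∀ H : Matrix (HamLearn.Bits n) (HamLearn.Bits n) ℂ, H.IsHermitian →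
              HamLearn.flaggedState K Δ PL PR H =
                ((HamLearn.vecNorm (HamLearn.choiVec (Complex.I •
                    HamLearn.logPartial K (HamLearn.evolution H (1 / Δ)))) /
                  HamLearn.logNorm K : ℝ) : ℂ) •
                  HamLearn.pseudoChoi ((Complex.I * ((Δ : ℝ) : ℂ)) •
                    HamLearn.logPartial K (HamLearn.evolution H (1 / Δ)))) := by
  refine ⟨1161, 3, by norm_num, fun n Δ ε δ hΔ hε hδ hδ1 => ⟨?_, ?_⟩⟩
  · exact ⟨_, _, _, HamLearn.bellLearner_uncontrolled n _ _,
      HamLearn.bellLearner_costBound n hΔ hε hδ hδ1, HamLearn.bellLearner_learnsStructure n hΔ hε hδ⟩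
  · have hK := HamLearn.one_le_truncation ((Δ : ℝ) / ε)
    exact ⟨_, HamLearn.repetitions (Δ / ε) δ, hK, HamLearn.exists_isLogPrepPair hK,
      fun PL PR h => ⟨HamLearn.logLearner_costBound n hΔ hε hδ hδ1 PL PR,
        HamLearn.logLearner_learnsStructure n hΔ hε hδ h,
        fun H _ => HamLearn.flaggedState_eq_pseudoChoi hK hΔ h H⟩⟩
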